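/- **Setting.** An event is a read $\mathtt r(x,v)$ or a write $\mathtt w(x,v)$ of a value $v$ at a location $x$. A partial execution graph $\overline X=\langle E,po\rangle$ is given by finitely many threads, each a finite sequence of events; $po$ is the strict order of the events within each thread. $\overline X$ is \emph{3-Writer} if every location is written by at most three threads. An execution graph $X=\langle E,po,rf,mo\rangle$ completes $\overline X$ by a relation $rf$ that assigns to every read exactly one write with the same location and value, and a relation $mo$ that is the union of strict total orders $mo_x$ on the writes to each location $x$. Let $hb=(po\cup rf)^+$. Then - $X\models\mathsf{WRA}$ iff $po\cup rf$ is acyclic and there are no $w\,rf\,r$ and no write $w'$ to the location of $r$ with $w\,hb\,w'\,hb\,r$; - $X\models\mathsf{RA}$ iff $po\cup rf$ is acyclic, there are no $a\,mo\,b$ with $b\,hb\,a$, and there are no $w\,rf\,r$, $w\,mo\,w'$ with $w'\,hb\,r$; - $X\models\mathsf{SRA}$ iff $po\cup rf$ is acyclic, $hb\cup mo$ is acyclic, and there are no $w\,rf\,r$, $w\,mo\,w'$ with $w'\,hb\,r$. $\overline X\models\mathcal M$ means that some $rf$ and $mo$ give $X\models\mathcal M$. Algorithms are (multi-stack) Turing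 machines; numbers are encoded in unary; in instances with $n$ events, locations and values are named by numbers less than $n$. ETH says that no algorithm decides satisfiability of 3-CNF formulas $\varphi$ with $k$ variables in time $2^{o(k)}\cdot|\varphi|^{O(1)}$. For a 3-CNF formula $\varphi=\bigwedge_{j<m}C_j$ in variables $x_i$ ($i<k$), with clauses of three (not necessarily distinct) literals, let $\overline X_\varphi$ have pairwise distinct locations $s_i,v_i$ ($i<k$), $c_j$ ($j<m$) and the following threads: for each $i<k$ and $b\in\{0,1\}$ the thread $T_i^b=\mathtt w(s_i,1)\,\mathtt w(s_i,2)\,\mathtt w(v_i,b)$ and a thread that consists of $\mathtt r(v_i,b)$ followed by $\mathtt w(c_j,1)$, in the order of $j$, for all $j$ such that $C_j$ contains the literal $x_i$ (if $b=1$), respectively $\neg x_i$ (if $b=0$); and a thread $T_f$ that consists of $\mathtt r(c_0,1)\cdots\mathtt r(c_{m-1},1)$ followed by $\mathtt r(s_i,2)\,\mathtt r(s_i,1)$ for $i=0,\dots,k-1$. **Theorem.** 1. Under ETH, for each $\mathcal M\in\{\mathsf{RA},\mathsf{SRA},\mathsf{WRA}\}$ there is no algorithm that decides, given a 3-Writer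 partial execution graph $\overline X$ with $k$ threads and $n$ events, whether $\overline X\models\mathcal M$ in time $2^{o(k)}\cdot n^{O(1)}$. 2. The map $\varphi\mapsto\overline X_\varphi$ is computable in polynomial time, and for every 3-CNF formula $\varphi$ with $k$ variables $\overline X_\varphi$ is 3-Writer, has $4k+1$ threads, and locations and values named by numbers less than its number of events. If $\varphi$ is satisfiable, then $\overline X_\varphi\models\mathsf{SRA}$. If $\overline X_\varphi\models\mathsf{WRA}$, then $\varphi$ is satisfiable. -/

import Mathlib

open Turing Filter Asymptotics

/-! ### Executions and memory models -/

/-- The kind of a memory operation. -/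
inductive OpKind where
  | read
  | write
deriving DecidableEq

/-- An event `r(x, v)` or `w(x, v)`; locations and values are named by natural numbers. -/
structure MemEvent where
  op : OpKind
  loc : ℕ
  val : ℕ

/-- A partial execution graph `⟨E, po⟩`, presented by its threads: each thread is the sequence of
its events, in program order. -/
abbrev PartialExec : Type := List (List MemEvent)

namespace PartialExec

/-- The number `k` of threads. -/
def numThreads (X : PartialExec) : ℕ := X.length

/-- The number `n` of events. -/
def numEvents (X : PartialExec) : ℕ := (X.map List.length).sum

/-- The events of `X`: a thread together with a position in it. -/
abbrev Ev (X : PartialExec) : Type := (t : Fin X.length) × Fin (X.get t).length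

/-- The memory operation performed by an event. -/
def lab (X : PartialExec) (e : X.Ev) : MemEvent := (X.get e.1).get e.2

/-- The (strict) program order. -/
def po (X : PartialExec) (a b : X.Ev) : Prop := a.1 = b.1 ∧ (a.2 : ℕ) < (b.2 : ℕ)

/-- The set of threads that write to location `x`. -/
def writers (X : PartialExec) (x : ℕ) : Set (Fin X.length) :=
  {t | ∃ e ∈ X.get t, e.op = OpKind.write ∧ e.loc = x}

/-- Every location is written by at most `d` threads. -/
def IsWriterBounded (d : ℕ) (X : PartialExec) : Prop := ∀ x : ℕ, (X.writers x).ncard ≤ d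

/-- Locations and values are named by numbers smaller than the number `n` of events (there are at
most `n` of either), so that the size of the input is polynomial in `k` and `n`. -/
def HasSmallNames (X : PartialExec) : Prop :=
  ∀ T ∈ X, ∀ e ∈ T, e.loc < X.numEvents ∧ e.val < X.numEvents

end PartialExec

/-- A (complete) execution graph on the partial execution graph `X`: a reads-from relation and a
modification order. -/
structure ExecutionGraph (X : PartialExec) where
  rf : X.Ev → X.Ev → Prop
  mo : X.Ev → X.Ev → Prop
  rf_spec : ∀ w r, rf w r → (X.lab w).op = OpKind.write ∧ (X.lab r).op = OpKind.read ∧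
    (X.lab w).loc = (X.lab r).loc ∧ (X.lab w).val = (X.lab r).val
  /-- Every read reads from exactly one write. -/
  rf_existsUnique : ∀ r, (X.lab r).op = OpKind.read → ∃! w, rf w r
  /-- `mo` relates only writes to one and the same location, ... -/
  mo_spec : ∀ a b, mo a b → (X.lab a).op = OpKind.write ∧ (X.lab b).op = OpKind.write ∧
    (X.lab a).loc = (X.lab b).loc
  /-- ... and is a strict total order on the writes to each location. -/
  mo_irrefl : ∀ a, ¬ mo a a
  mo_trans : ∀ a b c, mo a b → mo b c → mo a c
  mo_total : ∀ a b, (X.lab a).op = OpKind.write → (X.lab b).op = OpKind.write →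
    (X.lab a).loc = (X.lab b).loc → a ≠ b → mo a b ∨ mo b a

/-- The three memory models. -/
inductive MemModel where
  | RA
  | SRA
  | WRA

namespace ExecutionGraph

variable {X : PartialExec} (G : ExecutionGraph X)

/-- Happens-before: `hb = (po ∪ rf)⁺`. -/
def hb : X.Ev → X.Ev → Prop := Relation.TransGen fun a b => X.po a b ∨ G.rf a b

/-- `acy(po ∪ rf)`. -/
def PorfAcyclic : Prop := ∀ e, ¬ G.hb e e

/-- `irr(mo_x; hb)` for every location `x`. -/
def WriteCoherence : Prop := ∀ a b, G.mo a b → ¬ G.hb b a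

/-- `acy(hb ∪ mo)`. -/
def StrongWriteCoherence : Prop :=
  ∀ e, ¬ Relation.TransGen (fun a b => G.hb a b ∨ G.mo a b) e e

/-- `irr(rf⁻¹; mo_x; hb)` for every location `x`. -/
def ReadCoherence : Prop := ∀ r w w', G.rf w r → G.mo w w' → ¬ G.hb w' r

/-- `irr(hb; [W_x]; hb; rf_x⁻¹)` for every location `x`. -/
def WeakReadCoherence : Prop :=
  ∀ w w' r, G.rf w r → (X.lab w').op = OpKind.write → (X.lab w').loc = (X.lab r).loc →
    G.hb w w' → ¬ G.hb w' r

/-- `G ⊨ M`. -/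
def Satisfies : MemModel → Prop
  | MemModel.RA => G.PorfAcyclic ∧ G.WriteCoherence ∧ G.ReadCoherence
  | MemModel.SRA => G.PorfAcyclic ∧ G.StrongWriteCoherence ∧ G.ReadCoherence
  | MemModel.WRA => G.PorfAcyclic ∧ G.WeakReadCoherence

end ExecutionGraph

/-- `X ⊨ M`: some `rf` and `mo` complete `X` to an execution graph consistent with `M`. -/
def PartialExec.Consistent (X : PartialExec) (M : MemModel) : Prop :=
  ∃ G : ExecutionGraph X, G.Satisfies M

/-! ### 3-SAT -/

/-- A literal over the variables `x_0, …, x_{k-1}`: `(i, true)` is `x_i`, `(i, false)` is `¬ x_i`. -/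
abbrev Lit (k : ℕ) : Type := Fin k × Bool

/-- A 3-CNF formula: a list of clauses of three literals each. -/
structure Formula3 where
  numVars : ℕ
  clauses : List (Fin 3 → Lit numVars)

/-- Some assignment makes a literal of every clause true. -/
def Formula3.Satisfiable (φ : Formula3) : Prop :=
  ∃ A : Fin φ.numVars → Bool, ∀ C ∈ φ.clauses, ∃ p : Fin 3, A (C p).1 = (C p).2

/-! ### Encodings as words (numbers in unary) -/

/-- Alphabet for formulas. -/
inductive FormulaSym where
  | tick
  | pos
  | neg
deriving DecidableEq

/-- `k` ticks for the number of variables, then the literals of the clauses, each of them a sign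
followed by `i` ticks for the variable `x_i`. -/
def Formula3.encode (φ : Formula3) : List FormulaSym :=
  List.replicate φ.numVars FormulaSym.tick ++
    φ.clauses.flatMap fun C => (List.ofFn C).flatMap fun l =>
      (if l.2 then FormulaSym.pos else FormulaSym.neg) ::
        List.replicate (l.1 : ℕ) FormulaSym.tick

/-- Alphabet for executions. -/
inductive ExecSym where
  | tick
  | read
  | write
  | comma
  | semi
deriving DecidableEq

/-- The kind of the operation, the location, a comma, the value. -/
def MemEvent.encode (e : MemEvent) : List ExecSym :=
  (match e.op with
    | OpKind.read => ExecSym.read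
    | OpKind.write => ExecSym.write) ::
    (List.replicate e.loc ExecSym.tick ++ ExecSym.comma :: List.replicate e.val ExecSym.tick)

/-- The events of the threads in order, with a semicolon after each thread. -/
def PartialExec.encode (X : PartialExec) : List ExecSym :=
  List.flatMap (fun T => List.flatMap MemEvent.encode T ++ [ExecSym.semi]) X

/-! ### Deciding in bounded time, and the Exponential Time Hypothesis -/

/-- On input `x`, the Turing machine `A` halts after at most `t` steps and outputs the truth value
of `P`. -/
def DecidesInTime {S : Type} (A : TM2ComputableAux S Bool) (x : List S) (P : Prop) (t : ℝ) :
    Prop :=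
  ∃ (b : Bool) (s : ℕ), (b = true ↔ P) ∧ (s : ℝ) ≤ t ∧
    Nonempty (TM2OutputsInTime A.tm (x.map A.inputAlphabet.invFun)
      (some ([b].map A.outputAlphabet.invFun)) s)

/-- ETH: no algorithm decides 3-SAT in time `2^{o(k)} · |φ|^{O(1)}`, where `k` is the number of
variables of `φ`. (This follows from the form that excludes running time `2^{δ k} · |φ|^{O(1)}` for
some `δ > 0`; so as a hypothesis it is the weaker of the two usual forms.) -/
def ETH : Prop :=
  ¬ ∃ (A : TM2ComputableAux FormulaSym Bool) (f : ℕ → ℝ) (C c : ℕ),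
    (f =o[atTop] fun k : ℕ => (k : ℝ)) ∧
    ∀ φ : Formula3, DecidesInTime A φ.encode φ.Satisfiable
      (C * (2 : ℝ) ^ f φ.numVars * ((φ.encode.length : ℝ) + 1) ^ c)

/-- The algorithm `A` decides consistency under `M` for the executions with at most `d` writers per
location, in time `2^{o(k)} · n^{O(1)}` where `k` is the number of threads and `n` the number of
events. Nothing is required of `A` on other inputs. -/
def SolvesInSubexpTime (d : ℕ) (M : MemModel) (A : TM2ComputableAux ExecSym Bool) : Prop :=
  ∃ (f : ℕ → ℝ) (C c : ℕ), (f =o[atTop] fun k : ℕ => (k : ℝ)) ∧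
    ∀ X : PartialExec, X.IsWriterBounded d → X.HasSmallNames →
      DecidesInTime A X.encode (X.Consistent M)
        (C * (2 : ℝ) ^ f X.numThreads * ((X.numEvents : ℝ) + 1) ^ c)

/-! ### The reduction -/

namespace Formula3

variable (φ : Formula3)

/-- The locations `s_i`, `v_i` and `c_j` of the reduction. -/
def sLoc (i : Fin φ.numVars) : ℕ := i

def vLoc (i : Fin φ.numVars) : ℕ := φ.numVars + i

def cLoc (j : Fin φ.clauses.length) : ℕ := 2 * φ.numVars + j

/-- The thread `T_i^b`: `w(s_i, 1) w(s_i, 2) w(v_i, b)`. -/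
def valueThread (i : Fin φ.numVars) (b : Bool) : List MemEvent :=
  [⟨OpKind.write, φ.sLoc i, 1⟩, ⟨OpKind.write, φ.sLoc i, 2⟩, ⟨OpKind.write, φ.vLoc i, b.toNat⟩]

/-- The thread of the literal `l = (i, b)`: `r(v_i, b)`, then `w(c_j, 1)` for each clause `C_j` that
contains `l`. -/
def litThread (l : Lit φ.numVars) : List MemEvent :=
  ⟨OpKind.read, φ.vLoc l.1, l.2.toNat⟩ ::
    ((List.finRange φ.clauses.length).filter fun j => ∃ p : Fin 3, φ.clauses.get j p = l).map
      fun j => ⟨OpKind.write, φ.cLoc j, 1⟩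

/-- The thread `T_f`: `r(c_j, 1)` for all `j`, then `r(s_i, 2) r(s_i, 1)` for all `i`. -/
def finalThread : List MemEvent :=
  ((List.finRange φ.clauses.length).map fun j => ⟨OpKind.read, φ.cLoc j, 1⟩) ++
    (List.finRange φ.numVars).flatMap fun i =>
      [⟨OpKind.read, φ.sLoc i, 2⟩, ⟨OpKind.read, φ.sLoc i, 1⟩]

/-- The execution built from `φ`. -/
def toExec : PartialExec :=
  ((List.finRange φ.numVars).flatMap fun i =>
    [φ.valueThread i true, φ.valueThread i false, φ.litThread (i, true), φ.litThread (i, false)]) ++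
    [φ.finalThread]

end Formula3

/-! ### Relations between the memory models -/

namespace PartialExec

variable {X : PartialExec}

/-! In any consistent completion the read `r(s_i, 1)` of `T_f` takes its value from the write
`w(s_i, 1)` of one of the threads `T_i^0`, `T_i^1`, say of `T_i^b`. Weak read coherence forbids the
next write `w(s_i, 2)` of `T_i^b`, and therefore also `w(v_i, b)`, to happen before that read. The
thread of the literal `(i, b)` starts by reading `w(v_i, b)`, and `T_f` reads all `c_j` before it
reads any `s_i`; so no `r(c_j, 1)` can be served by that thread. Each clause is thus served by a
literal `(i, ¬b)`, and the assignment that makes these literals true satisfies the formula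
(`satisfiable_of_consistent_WRA`).

Conversely, a satisfying assignment `A` gives an interleaving of all events in which each read sees
the latest write to its location. The threads `T_i^{A i}` run first, then the true literals, then
`T_f`, where the first write of `T_i^{¬A i}` is inserted between `r(s_i, 2)` and `r(s_i, 1)`; the
rest follows. Such an interleaving is consistent even with SRA (`consistent_SRA_of_rank`,
`consistent_SRA_of_satisfiable`). As SRA implies RA and RA implies WRA, the three models agree on
these executions (`consistent_iff_satisfiable`).

The execution has `4k + 1` threads and polynomially many events, so an algorithm for consistency in
time `2^{o(k)} · n^{O(1)}`, run after the reduction, would refute ETH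
(`exists_solver_of_solvesInSubexpTime`). On stack machines this needs a machine for the reduction
and the composition of machines, both with step counts. The reduction is written in a small
while-language whose runs translate into machine steps (`StackProg.Run.stepsTo`);
`Reduction.run_prog` gives its correctness and cost, and `FinTM2.comp_outputsInTime` the
composition. -/

theorem Ev.ext' {a b : X.Ev} (h : a.1 = b.1) (h' : (a.2 : ℕ) = b.2) : a = b := by
  obtain ⟨t, p⟩ := a
  obtain ⟨t', p'⟩ := b
  dsimp only at h
  subst h
  exact congrArg _ (Fin.ext h')

theorem getElem?_lab (e : X.Ev) : (X.get e.1)[(e.2 : ℕ)]? = some (X.lab e) := by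
  simp [lab]

theorem exists_ev {t p : ℕ} {T : List MemEvent} {a : MemEvent} (ht : X[t]? = some T)
    (hp : T[p]? = some a) : ∃ e : X.Ev, (e.1 : ℕ) = t ∧ (e.2 : ℕ) = p ∧ X.lab e = a := by
  obtain ⟨h, rfl⟩ := List.getElem?_eq_some_iff.1 ht
  obtain ⟨h', rfl⟩ := List.getElem?_eq_some_iff.1 hp
  exact ⟨⟨⟨t, h⟩, ⟨p, h'⟩⟩, rfl, rfl, rfl⟩

/-- A linear arrangement of the events in which every read sees the latest write to its location
yields an execution graph that is consistent with the strongest model. -/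
theorem consistent_SRA_of_rank {α : Type*} [LinearOrder α] (rank : X.Ev → α)
    (hpo : ∀ a b, X.po a b → rank a < rank b)
    (hinj : ∀ a b, (X.lab a).op = OpKind.write → (X.lab b).op = OpKind.write →
      (X.lab a).loc = (X.lab b).loc → rank a = rank b → a = b)
    (hread : ∀ r, (X.lab r).op = OpKind.read → ∃ w, (X.lab w).op = OpKind.write ∧
      (X.lab w).loc = (X.lab r).loc ∧ (X.lab w).val = (X.lab r).val ∧ rank w < rank r ∧
      ∀ w', (X.lab w').op = OpKind.write → (X.lab w').loc = (X.lab r).loc →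
        rank w' < rank r → rank w' ≤ rank w) :
    X.Consistent MemModel.SRA := by
  -- Each read takes the write of largest rank before it. By `hinj` that source is unique and `mo`
  -- is total; events at different locations may share a rank.
  let G : ExecutionGraph X :=
    { rf := fun w r => (X.lab r).op = OpKind.read ∧ (X.lab w).op = OpKind.write ∧
        (X.lab w).loc = (X.lab r).loc ∧ (X.lab w).val = (X.lab r).val ∧ rank w < rank r ∧
        ∀ w', (X.lab w').op = OpKind.write → (X.lab w').loc = (X.lab r).loc →
          rank w' < rank r → rank w' ≤ rank w
      mo := fun a b => (X.lab a).op = OpKind.write ∧ (X.lab b).op = OpKind.write ∧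
        (X.lab a).loc = (X.lab b).loc ∧ rank a < rank b
      rf_spec := fun w r h => ⟨h.2.1, h.1, h.2.2.1, h.2.2.2.1⟩
      rf_existsUnique := by
        intro r hr
        obtain ⟨w, hw⟩ := hread r hr
        refine ⟨w, ⟨hr, hw⟩, ?_⟩
        rintro w' ⟨-, h1, h2, -, h4, h5⟩
        exact hinj _ _ h1 hw.1 (h2.trans hw.2.1.symm)
          (le_antisymm (hw.2.2.2.2 w' h1 h2 h4) (h5 w hw.1 hw.2.1 hw.2.2.2.1))
      mo_spec := fun a b h => ⟨h.1, h.2.1, h.2.2.1⟩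
      mo_irrefl := fun a h => lt_irrefl _ h.2.2.2
      mo_trans := fun a b c h h' =>
        ⟨h.1, h'.2.1, h.2.2.1.trans h'.2.2.1, h.2.2.2.trans h'.2.2.2⟩
      mo_total := by
        intro a b ha hb hab hne
        rcases lt_trichotomy (rank a) (rank b) with h | h | h
        · exact Or.inl ⟨ha, hb, hab, h⟩
        · exact absurd (hinj a b ha hb hab h) hne
        · exact Or.inr ⟨hb, ha, hab.symm, h⟩ }
  -- Both `po` and `rf` increase the rank, hence so do `hb` and `mo`, and cycles are impossible.
  have hhb : ∀ a b, G.hb a b → rank a < rank b := by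
    intro a b h
    induction h with
    | single h => exact h.elim (hpo _ _) fun h => h.2.2.2.2.1
    | tail _ h ih => exact ih.trans (h.elim (hpo _ _) fun h => h.2.2.2.2.1)
  refine ⟨G, fun e h => lt_irrefl _ (hhb _ _ h), fun e h => ?_, ?_⟩
  · have : ∀ a b, Relation.TransGen (fun a b => G.hb a b ∨ G.mo a b) a b → rank a < rank b := by
      intro a b h
      induction h with
      | single h => exact h.elim (hhb _ _) fun h => h.2.2.2
      | tail _ h ih => exact ih.trans (h.elim (hhb _ _) fun h => h.2.2.2)
    exact lt_irrefl _ (this _ _ h)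
  · intro r w w' hrf hmo h
    exact absurd (hrf.2.2.2.2.2 w' hmo.2.1 (hmo.2.2.1.symm.trans hrf.2.2.1) (hhb _ _ h))
      (not_le.2 hmo.2.2.2)

/-- A `mo` edge with an `hb` edge back is a cycle of length two in `hb ∪ mo`. -/
theorem Consistent.RA_of_SRA (h : X.Consistent MemModel.SRA) : X.Consistent MemModel.RA := by
  obtain ⟨G, h1, h2, h3⟩ := h
  exact ⟨G, h1, fun a b hab hba =>
    h2 a (.tail (.single (Or.inr hab)) (Or.inl hba)), h3⟩

/-- For `w hb w' hb r` the writes `w` and `w'` are comparable by `mo`: if `w` comes first, read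
coherence fails, otherwise write coherence. -/
theorem Consistent.WRA_of_RA (h : X.Consistent MemModel.RA) : X.Consistent MemModel.WRA := by
  obtain ⟨G, h1, h2, h3⟩ := h
  refine ⟨G, h1, fun w w' r hrf hw' hloc hww' hw'r => ?_⟩
  obtain ⟨hw, -, hl, -⟩ := G.rf_spec w r hrf
  have hne : w ≠ w' := by
    rintro rfl
    exact h1 _ hww'
  rcases G.mo_total w w' hw hw' (hl.trans hloc.symm) hne with h | h
  · exact h3 r w w' hrf h hw'r
  · exact h2 _ _ h hww'

end PartialExec

/-! ### The events of the reduction -/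

/-- Blocks of equal length make a position split into quotient and remainder. This locates the four
threads of a variable and the two reads of `s_i` in `T_f`. -/
theorem List.getElem?_flatMap_of_length {α β : Type*} {f : α → List β} {n : ℕ}
    (hf : ∀ a, (f a).length = n) (l : List α) (i : ℕ) {r : ℕ} (hr : r < n) :
    (l.flatMap f)[n * i + r]? = l[i]?.bind fun a => (f a)[r]? := by
  induction l generalizing i with
  | nil => simp
  | cons a l ih =>
    rw [List.flatMap_cons]
    cases i with
    | zero => rw [List.getElem?_append_left (by simpa [hf] using hr)]; simp
    | succ i =>
      rw [List.getElem?_append_right (by rw [hf, mul_add]; omega)]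
      rw [hf, show n * (i + 1) + r - n = n * i + r by rw [mul_add]; omega, ih]
      simp

theorem List.length_flatMap_of_length {α β : Type*} {f : α → List β} {n : ℕ}
    (hf : ∀ a, (f a).length = n) (l : List α) : (l.flatMap f).length = n * l.length := by
  simp [List.length_flatMap, hf, mul_comm]

namespace Formula3

variable (φ : Formula3)

/-- The index of the thread `T_i^b`. -/
def valIdx (i : Fin φ.numVars) (b : Bool) : ℕ := 4 * i + (if b then 0 else 1)

/-- The index of the thread of the literal `(i, b)`. -/
def litIdx (i : Fin φ.numVars) (b : Bool) : ℕ := 4 * i + (if b then 2 else 3)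

theorem length_varThreads : ((List.finRange φ.numVars).flatMap fun i => [φ.valueThread i true,
    φ.valueThread i false, φ.litThread (i, true), φ.litThread (i, false)]).length =
      4 * φ.numVars := by
  rw [List.length_flatMap_of_length (n := 4) (fun _ => rfl)]
  simp

theorem length_toExec : φ.toExec.length = 4 * φ.numVars + 1 := by
  rw [toExec, List.length_append, length_varThreads]
  rfl

theorem getElem?_toExec_valIdx (i : Fin φ.numVars) (b : Bool) :
    φ.toExec[φ.valIdx i b]? = some (φ.valueThread i b) := by
  have hi := i.2
  have hl := φ.length_varThreads
  rw [toExec, valIdx, List.getElem?_append_left (by rw [hl]; split <;> omega),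
    List.getElem?_flatMap_of_length (n := 4) (fun _ => rfl) _ _ (by split <;> omega)]
  cases b <;> simp

theorem getElem?_toExec_litIdx (i : Fin φ.numVars) (b : Bool) :
    φ.toExec[φ.litIdx i b]? = some (φ.litThread (i, b)) := by
  have hi := i.2
  have hl := φ.length_varThreads
  rw [toExec, litIdx, List.getElem?_append_left (by rw [hl]; split <;> omega),
    List.getElem?_flatMap_of_length (n := 4) (fun _ => rfl) _ _ (by split <;> omega)]
  cases b <;> simp

theorem getElem?_toExec_final : φ.toExec[4 * φ.numVars]? = some φ.finalThread := by
  have hl := φ.length_varThreads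
  rw [toExec, List.getElem?_append_right (by rw [hl]), hl]
  simp

theorem getElem?_finalThread_clause (j : Fin φ.clauses.length) :
    φ.finalThread[(j : ℕ)]? = some ⟨OpKind.read, φ.cLoc j, 1⟩ := by
  rw [finalThread, List.getElem?_append_left (by simp)]
  simp

theorem getElem?_finalThread_var (i : Fin φ.numVars) {r : ℕ} (hr : r < 2) :
    φ.finalThread[φ.clauses.length + (2 * (i : ℕ) + r)]? =
      [(⟨OpKind.read, φ.sLoc i, 2⟩ : MemEvent), ⟨OpKind.read, φ.sLoc i, 1⟩][r]? := by
  rw [finalThread, List.getElem?_append_right (by simp)]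
  simp only [List.length_map, List.length_finRange, Nat.add_sub_cancel_left]
  rw [List.getElem?_flatMap_of_length (n := 2) (fun _ => rfl) _ _ hr]
  simp

theorem length_finalThread : φ.finalThread.length = φ.clauses.length + 2 * φ.numVars := by
  rw [finalThread, List.length_append, List.length_flatMap_of_length (n := 2) (fun _ => rfl)]
  simp

/-- The events of `φ.toExec`. -/
inductive Node
  | val (i : Fin φ.numVars) (b : Bool) (p : Fin 3)
  | litRead (i : Fin φ.numVars) (b : Bool)
  | litWrite (i : Fin φ.numVars) (b : Bool) (j : Fin φ.clauses.length) (q : ℕ)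
  | clauseRead (j : Fin φ.clauses.length)
  | varRead (i : Fin φ.numVars) (r : Fin 2)

namespace Node

variable {φ}

/-- The thread of an event. -/
def tid : φ.Node → ℕ
  | val i b _ => φ.valIdx i b
  | litRead i b => φ.litIdx i b
  | litWrite i b _ _ => φ.litIdx i b
  | clauseRead _ => 4 * φ.numVars
  | varRead _ _ => 4 * φ.numVars

/-- The position of an event in its thread. -/
def pos : φ.Node → ℕ
  | val _ _ p => p
  | litRead _ _ => 0
  | litWrite _ _ _ q => q + 1
  | clauseRead j => j
  | varRead i r => φ.clauses.length + (2 * (i : ℕ) + r)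

/-- The memory operation of an event. -/
def lab : φ.Node → MemEvent
  | val i _ 0 => ⟨OpKind.write, φ.sLoc i, 1⟩
  | val i _ 1 => ⟨OpKind.write, φ.sLoc i, 2⟩
  | val i b 2 => ⟨OpKind.write, φ.vLoc i, b.toNat⟩
  | litRead i b => ⟨OpKind.read, φ.vLoc i, b.toNat⟩
  | litWrite _ _ j _ => ⟨OpKind.write, φ.cLoc j, 1⟩
  | clauseRead j => ⟨OpKind.read, φ.cLoc j, 1⟩
  | varRead i 0 => ⟨OpKind.read, φ.sLoc i, 2⟩
  | varRead i 1 => ⟨OpKind.read, φ.sLoc i, 1⟩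

/-- The writes of literal threads belong to clauses that contain the literal. -/
def Valid : φ.Node → Prop
  | litWrite i b j _ => ∃ p : Fin 3, φ.clauses.get j p = (i, b)
  | _ => True

end Node

variable {φ} in
-- Dividing the thread index by four yields the variable and the kind of thread, with the index `4k`
-- left for `T_f`. Later case distinctions can then run over the shapes of `Node` instead of list
-- positions.
theorem exists_node_of_getElem? {t q : ℕ} {T : List MemEvent} {a : MemEvent}
    (hT : φ.toExec[t]? = some T) (hp : T[q]? = some a) :
    ∃ n : φ.Node, n.Valid ∧ n.tid = t ∧ n.pos = q ∧ n.lab = a := by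
  have hl := φ.length_toExec
  have ht := (List.getElem?_eq_some_iff.1 hT).1
  have hlen := (List.getElem?_eq_some_iff.1 hp).1
  rcases Nat.lt_or_ge t (4 * φ.numVars) with h | h
  · obtain ⟨i, hi⟩ : ∃ i : Fin φ.numVars, (i : ℕ) = t / 4 :=
      ⟨⟨t / 4, by omega⟩, rfl⟩
    have hcase : (∃ b, φ.valIdx i b = t) ∨ ∃ b, φ.litIdx i b = t := by
      have : t % 4 = 0 ∨ t % 4 = 1 ∨ t % 4 = 2 ∨ t % 4 = 3 := by
        omega
      rcases this with h | h | h | h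
      · exact Or.inl ⟨true, by simp [valIdx]; omega⟩
      · exact Or.inl ⟨false, by simp [valIdx]; omega⟩
      · exact Or.inr ⟨true, by simp [litIdx]; omega⟩
      · exact Or.inr ⟨false, by simp [litIdx]; omega⟩
    rcases hcase with ⟨b, hb⟩ | ⟨b, hb⟩
    · rw [← hb, getElem?_toExec_valIdx, Option.some_inj] at hT
      subst hT
      have hq : q < 3 := hlen
      refine ⟨.val i b ⟨q, hq⟩, trivial, hb, rfl, ?_⟩
      interval_cases q <;> exact Option.some.inj hp
    · rw [← hb, getElem?_toExec_litIdx, Option.some_inj] at hT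
      subst hT
      rcases q with _ | q
      · exact ⟨.litRead i b, trivial, hb, rfl, Option.some.inj hp⟩
      · simp only [litThread, List.getElem?_cons_succ, List.getElem?_map,
          Option.map_eq_some_iff] at hp
        obtain ⟨j, hj, rfl⟩ := hp
        have := List.mem_of_getElem? hj
        exact ⟨.litWrite i b j q, by simpa [Node.Valid] using this, hb, rfl, rfl⟩
  · have h4 : t = 4 * φ.numVars := by omega
    rw [h4, getElem?_toExec_final, Option.some_inj] at hT
    subst hT
    rw [length_finalThread] at hlen
    rw [h4]
    rcases Nat.lt_or_ge q φ.clauses.length with h | h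
    · rw [getElem?_finalThread_clause φ ⟨q, h⟩, Option.some_inj] at hp
      exact ⟨.clauseRead ⟨q, h⟩, trivial, rfl, rfl, hp⟩
    · obtain ⟨i, hi⟩ : ∃ i : Fin φ.numVars, (i : ℕ) = (q - φ.clauses.length) / 2 :=
        ⟨⟨(q - φ.clauses.length) / 2, by omega⟩, rfl⟩
      obtain ⟨r, hr⟩ : ∃ r : Fin 2, (r : ℕ) = (q - φ.clauses.length) % 2 :=
        ⟨⟨(q - φ.clauses.length) % 2, by omega⟩, rfl⟩
      have hq : q = φ.clauses.length + (2 * (i : ℕ) + r) := by omega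
      rw [hq, getElem?_finalThread_var φ i r.2] at hp
      refine ⟨.varRead i r, trivial, rfl, hq.symm, ?_⟩
      fin_cases r <;> exact Option.some.inj hp

theorem exists_node (e : φ.toExec.Ev) :
    ∃ n : φ.Node, n.Valid ∧ n.tid = e.1 ∧ n.pos = e.2 ∧ n.lab = φ.toExec.lab e :=
  exists_node_of_getElem? (by simp) (PartialExec.getElem?_lab e)

theorem exists_ev_val (i : Fin φ.numVars) (b : Bool) (p : Fin 3) :
    ∃ e : φ.toExec.Ev, (e.1 : ℕ) = φ.valIdx i b ∧ (e.2 : ℕ) = p ∧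
      φ.toExec.lab e = (Node.val i b p).lab := by
  refine PartialExec.exists_ev (φ.getElem?_toExec_valIdx i b) ?_
  fin_cases p <;> rfl

theorem exists_ev_litRead (i : Fin φ.numVars) (b : Bool) :
    ∃ e : φ.toExec.Ev, (e.1 : ℕ) = φ.litIdx i b ∧ (e.2 : ℕ) = 0 ∧
      φ.toExec.lab e = (Node.litRead i b).lab :=
  PartialExec.exists_ev (φ.getElem?_toExec_litIdx i b) rfl

theorem exists_ev_litWrite {i : Fin φ.numVars} {b : Bool} {j : Fin φ.clauses.length}
    (h : ∃ p : Fin 3, φ.clauses.get j p = (i, b)) :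
    ∃ e : φ.toExec.Ev, (e.1 : ℕ) = φ.litIdx i b ∧
      φ.toExec.lab e = ⟨OpKind.write, φ.cLoc j, 1⟩ := by
  have hmem : j ∈ (List.finRange φ.clauses.length).filter
      fun j => ∃ p : Fin 3, φ.clauses.get j p = (i, b) := by simpa using h
  obtain ⟨q, hq⟩ := List.mem_iff_getElem?.1 hmem
  obtain ⟨e, h1, -, h3⟩ := PartialExec.exists_ev (φ.getElem?_toExec_litIdx i b)
    (p := q + 1) (a := ⟨OpKind.write, φ.cLoc j, 1⟩) (by
      simp only [litThread, List.getElem?_cons_succ, List.getElem?_map, hq, Option.map_some])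
  exact ⟨e, h1, h3⟩

theorem exists_ev_clauseRead (j : Fin φ.clauses.length) :
    ∃ e : φ.toExec.Ev, (e.1 : ℕ) = 4 * φ.numVars ∧ (e.2 : ℕ) = j ∧
      φ.toExec.lab e = (Node.clauseRead j).lab :=
  PartialExec.exists_ev φ.getElem?_toExec_final (φ.getElem?_finalThread_clause j)

theorem exists_ev_varRead (i : Fin φ.numVars) (r : Fin 2) :
    ∃ e : φ.toExec.Ev, (e.1 : ℕ) = 4 * φ.numVars ∧
      (e.2 : ℕ) = φ.clauses.length + (2 * (i : ℕ) + r) ∧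
      φ.toExec.lab e = (Node.varRead i r).lab := by
  refine PartialExec.exists_ev φ.getElem?_toExec_final
    ((φ.getElem?_finalThread_var i r.2).trans ?_)
  fin_cases r <;> rfl

end Formula3

/-! ### The interleaving given by an assignment -/

namespace Formula3

variable {φ : Formula3}

theorem valIdx_inj {i i' : Fin φ.numVars} {b b' : Bool} :
    φ.valIdx i b = φ.valIdx i' b' ↔ i = i' ∧ b = b' := by
  rw [Fin.ext_iff]
  cases b <;> cases b' <;> simp [valIdx] <;> omega

theorem litIdx_inj {i i' : Fin φ.numVars} {b b' : Bool} :
    φ.litIdx i b = φ.litIdx i' b' ↔ i = i' ∧ b = b' := by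
  rw [Fin.ext_iff]
  cases b <;> cases b' <;> simp [litIdx] <;> omega

theorem valIdx_ne_litIdx {i i' : Fin φ.numVars} {b b' : Bool} :
    φ.valIdx i b ≠ φ.litIdx i' b' := by
  cases b <;> cases b' <;> simp [valIdx, litIdx] <;> omega

theorem valIdx_lt (i : Fin φ.numVars) (b : Bool) : φ.valIdx i b < 4 * φ.numVars := by
  have := i.2
  cases b <;> simp [valIdx] <;> omega

theorem litIdx_lt (i : Fin φ.numVars) (b : Bool) : φ.litIdx i b < 4 * φ.numVars := by
  have := i.2
  cases b <;> simp [litIdx] <;> omega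

theorem cLoc_inj {j j' : Fin φ.clauses.length} : φ.cLoc j = φ.cLoc j' ↔ j = j' := by
  simp [cLoc, Fin.ext_iff]

namespace Node

/-- Thread and position alone do not settle a `litWrite`: its clause `j` and its position `q` are
independent fields. The location in the label recovers `j`. -/
theorem eq_of_tid_pos {n n' : φ.Node} (ht : n.tid = n'.tid) (hp : n.pos = n'.pos)
    (hl : n.lab = n'.lab) : n = n' := by
  rcases n with ⟨i, b, p⟩ | ⟨i, b⟩ | ⟨i, b, j, q⟩ | j | ⟨i, r⟩ <;>
  rcases n' with ⟨i', b', p'⟩ | ⟨i', b'⟩ | ⟨i', b', j', q'⟩ | j' | ⟨i', r'⟩ <;>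
  simp only [tid, pos, valIdx_inj, litIdx_inj, valIdx_ne_litIdx, valIdx_ne_litIdx.symm,
    (valIdx_lt _ _).ne, (valIdx_lt _ _).ne', (litIdx_lt _ _).ne, (litIdx_lt _ _).ne'] at ht hp
  · obtain ⟨rfl, rfl⟩ := ht
    rw [Fin.ext hp]
  · obtain ⟨rfl, rfl⟩ := ht
    rfl
  · omega
  · omega
  · obtain ⟨rfl, rfl⟩ := ht
    obtain rfl : q = q' := by omega
    simp only [lab, MemEvent.mk.injEq, cLoc_inj] at hl
    rw [hl.2.1]
  · rw [Fin.ext hp]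
  · have := j.2; omega
  · have := j'.2; omega
  · rw [show i = i' from Fin.ext (by omega), show r = r' from Fin.ext (by omega)]

/-- The place of an event in the linear arrangement given by an assignment `A`. -/
def rank (A : Fin φ.numVars → Bool) : φ.Node → ℕ ×ₗ ℕ ×ₗ ℕ
  -- The first component is a stage: 0 for the threads `T_i^{A i}`, 1 for the true literals, 2 for
  -- `T_f`, 3 for the rest of the other value threads, 4 for the false literals. The last component
  -- 1 in stage 2 puts `w(s_i, 1)` of `T_i^{¬A i}` right after `r(s_i, 2)`, which has the same
  -- middle component and last component 0.
  | val i b p => if b = A i then toLex (0, toLex (0, (p : ℕ))) else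
      if p = 0 then toLex (2, toLex (φ.clauses.length + 2 * (i : ℕ), 1)) else
        toLex (3, toLex (0, (p : ℕ)))
  | litRead i b => toLex (if b = A i then 1 else 4, toLex (φ.litIdx i b, 0))
  | litWrite i b _ q => toLex (if b = A i then 1 else 4, toLex (φ.litIdx i b, q + 1))
  | clauseRead j => toLex (2, toLex (j, 0))
  | varRead i r => toLex (2, toLex (φ.clauses.length + (2 * (i : ℕ) + r), 0))

theorem lex_lt_iff {a b c a' b' c' : ℕ} :
    (toLex (a, toLex (b, c)) : ℕ ×ₗ ℕ ×ₗ ℕ) < toLex (a', toLex (b', c')) ↔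
      a < a' ∨ a = a' ∧ (b < b' ∨ b = b' ∧ c < c') := by
  simp [Prod.Lex.lt_iff]

theorem lex_le_iff {a b c a' b' c' : ℕ} :
    (toLex (a, toLex (b, c)) : ℕ ×ₗ ℕ ×ₗ ℕ) ≤ toLex (a', toLex (b', c')) ↔
      a < a' ∨ a = a' ∧ (b < b' ∨ b = b' ∧ c ≤ c') := by
  simp [Prod.Lex.le_iff]

theorem lex_eq_iff {a b c a' b' c' : ℕ} :
    (toLex (a, toLex (b, c)) : ℕ ×ₗ ℕ ×ₗ ℕ) = toLex (a', toLex (b', c')) ↔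
      a = a' ∧ b = b' ∧ c = c' := by
  simp

theorem rank_lt_rank (A : Fin φ.numVars → Bool) {n n' : φ.Node} (ht : n.tid = n'.tid)
    (hp : n.pos < n'.pos) : n.rank A < n'.rank A := by
  rcases n with ⟨i, b, p⟩ | ⟨i, b⟩ | ⟨i, b, j, q⟩ | j | ⟨i, r⟩ <;>
  rcases n' with ⟨i', b', p'⟩ | ⟨i', b'⟩ | ⟨i', b', j', q'⟩ | j' | ⟨i', r'⟩ <;>
  simp only [tid, pos, valIdx_inj, litIdx_inj, valIdx_ne_litIdx, valIdx_ne_litIdx.symm,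
    (valIdx_lt _ _).ne, (valIdx_lt _ _).ne', (litIdx_lt _ _).ne, (litIdx_lt _ _).ne'] at ht hp <;>
  simp only [rank]
  · obtain ⟨rfl, rfl⟩ := ht
    have h0 : ∀ p : Fin 3, p = 0 ↔ (p : ℕ) = 0 := fun p => Fin.ext_iff
    split_ifs with h1 h2 h3 h3 <;> rw [lex_lt_iff] <;>
      simp only [h0 p, h0 p'] at * <;> first | omega | simp [hp]
  · omega
  · obtain ⟨rfl, rfl⟩ := ht
    rw [lex_lt_iff]; omega
  · omega
  · obtain ⟨rfl, rfl⟩ := ht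
    rw [lex_lt_iff]; omega
  all_goals rw [lex_lt_iff]; omega

/-- The threads `T_i^{A i}` for different `i` share their ranks, so a write is determined by its
rank only together with its location, which fixes `i`. -/
theorem eq_of_rank_eq (A : Fin φ.numVars → Bool) {n n' : φ.Node} (hw : n.lab.op = OpKind.write)
    (hw' : n'.lab.op = OpKind.write) (hl : n.lab.loc = n'.lab.loc)
    (hr : n.rank A = n'.rank A) : n = n' := by
  have key : ∀ i : Fin φ.numVars, ∀ b b', b ≠ A i → b' ≠ A i → b = b' := by
    intro i b b' h h'
    cases b <;> cases b' <;> simp_all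
  rcases n with ⟨i, b, p⟩ | ⟨i, b⟩ | ⟨i, b, j, q⟩ | j | ⟨i, r⟩ <;>
  rcases n' with ⟨i', b', p'⟩ | ⟨i', b'⟩ | ⟨i', b', j', q'⟩ | j' | ⟨i', r'⟩ <;>
  try (first | (fin_cases r <;> cases hw) | (fin_cases r' <;> cases hw') |
    (cases hw; done) | (cases hw'; done))
  · have hi : i = i' := by
      have := i.2
      have := i'.2
      fin_cases p <;> fin_cases p' <;> simp [lab, sLoc, vLoc] at hl <;> omega
    subst hi
    simp only [rank, Fin.ext_iff] at hr
    split_ifs at hr <;> simp only [lex_eq_iff] at hr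
    · subst_vars
      rw [Fin.ext hr.2.2]
    all_goals first | omega | skip
    all_goals
      obtain rfl := key i b b' ‹_› ‹_›
      rw [show p = p' from Fin.ext (by simp at *; omega)]
  · have := i.2
    fin_cases p <;> simp [lab, sLoc, vLoc, cLoc] at hl <;> omega
  · have := i'.2
    fin_cases p' <;> simp [lab, sLoc, vLoc, cLoc] at hl <;> omega
  · simp only [lab, cLoc_inj] at hl
    simp only [rank, lex_eq_iff, litIdx_inj] at hr
    obtain ⟨-, ⟨rfl, rfl⟩, h⟩ := hr
    obtain rfl : q = q' := by omega
    rw [hl]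

end Node

/-! ### Satisfiability and consistency -/

/-- The description of an event. -/
noncomputable def node (e : φ.toExec.Ev) : φ.Node := (φ.exists_node e).choose

theorem node_valid (e : φ.toExec.Ev) : (node e).Valid := (φ.exists_node e).choose_spec.1

theorem tid_node (e : φ.toExec.Ev) : (node e).tid = e.1 := (φ.exists_node e).choose_spec.2.1

theorem pos_node (e : φ.toExec.Ev) : (node e).pos = e.2 := (φ.exists_node e).choose_spec.2.2.1

theorem lab_node (e : φ.toExec.Ev) : (node e).lab = φ.toExec.lab e :=
  (φ.exists_node e).choose_spec.2.2.2

theorem node_injective : Function.Injective (node (φ := φ)) := by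
  intro e e' h
  refine PartialExec.Ev.ext' (Fin.ext ?_) ?_
  · rw [← tid_node, ← tid_node, h]
  · rw [← pos_node, ← pos_node, h]

theorem exists_node_eq_val (i : Fin φ.numVars) (b : Bool) (p : Fin 3) :
    ∃ e : φ.toExec.Ev, node e = .val i b p := by
  obtain ⟨e, h1, h2, h3⟩ := φ.exists_ev_val i b p
  exact ⟨e, Node.eq_of_tid_pos ((tid_node e).trans h1) ((pos_node e).trans h2)
    ((lab_node e).trans h3)⟩

theorem exists_node_eq_litRead (i : Fin φ.numVars) (b : Bool) :
    ∃ e : φ.toExec.Ev, node e = .litRead i b := by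
  obtain ⟨e, h1, h2, h3⟩ := φ.exists_ev_litRead i b
  exact ⟨e, Node.eq_of_tid_pos ((tid_node e).trans h1) ((pos_node e).trans h2)
    ((lab_node e).trans h3)⟩

theorem exists_node_eq_clauseRead (j : Fin φ.clauses.length) :
    ∃ e : φ.toExec.Ev, node e = .clauseRead j := by
  obtain ⟨e, h1, h2, h3⟩ := φ.exists_ev_clauseRead j
  exact ⟨e, Node.eq_of_tid_pos ((tid_node e).trans h1) ((pos_node e).trans h2)
    ((lab_node e).trans h3)⟩

theorem exists_node_eq_varRead (i : Fin φ.numVars) (r : Fin 2) :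
    ∃ e : φ.toExec.Ev, node e = .varRead i r := by
  obtain ⟨e, h1, h2, h3⟩ := φ.exists_ev_varRead i r
  exact ⟨e, Node.eq_of_tid_pos ((tid_node e).trans h1) ((pos_node e).trans h2)
    ((lab_node e).trans h3)⟩

theorem exists_node_eq_litWrite {i : Fin φ.numVars} {b : Bool} {j : Fin φ.clauses.length}
    (h : ∃ p : Fin 3, φ.clauses.get j p = (i, b)) :
    ∃ (e : φ.toExec.Ev) (q : ℕ), node e = .litWrite i b j q := by
  obtain ⟨e, h1, h2⟩ := φ.exists_ev_litWrite h
  refine ⟨e, (e.2 : ℕ) - 1, Node.eq_of_tid_pos ((tid_node e).trans h1) ?_ ((lab_node e).trans h2)⟩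
  rw [pos_node]
  have hl : (node e).lab = ⟨OpKind.write, φ.cLoc j, 1⟩ := (lab_node e).trans h2
  have ht := (tid_node e).trans h1
  have hp := pos_node e
  revert hl ht hp
  rcases node e with ⟨i, b, p⟩ | ⟨i, b⟩ | ⟨i, b, j, q⟩ | j | ⟨i, r⟩ <;> intro hl ht hp
  · exact absurd ht valIdx_ne_litIdx
  · cases congrArg MemEvent.op hl
  · simp only [Node.pos] at hp ⊢
    omega
  · cases congrArg MemEvent.op hl
  · exact absurd ht (litIdx_lt _ _).ne'

/-- It remains to check, for each kind of read, that the latest earlier write to its location in the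
order of `Node.rank` has the required value. -/
theorem consistent_SRA_of_satisfiable (h : φ.Satisfiable) :
    φ.toExec.Consistent MemModel.SRA := by
  obtain ⟨A, hA⟩ := h
  refine PartialExec.consistent_SRA_of_rank (fun e => (node e).rank A) ?_ ?_ ?_
  · intro a b hab
    refine Node.rank_lt_rank A ?_ ?_
    · rw [tid_node, tid_node, hab.1]
    · rw [pos_node, pos_node]; exact hab.2
  · intro a b ha hb hl hr
    rw [← lab_node] at ha hb
    rw [← lab_node, ← lab_node] at hl
    exact node_injective (Node.eq_of_rank_eq A ha hb hl hr)
  · intro r hr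
    rw [← lab_node] at hr ⊢
    simp only [← lab_node]
    have hval := node_valid r
    rcases hn : node r with ⟨i, b, p⟩ | ⟨i, b⟩ | ⟨i, b, j, q⟩ | j | ⟨i, s⟩ <;>
      rw [hn] at hr hval
    · fin_cases p <;> cases hr
    -- If `b = A i`, the competing write to `v_i` comes only in stage 3, after this read in stage 1.
    -- Otherwise it came already in stage 0, before the source in stage 3.
    · obtain ⟨w, hw⟩ := exists_node_eq_val i b 2
      refine ⟨w, by rw [hw]; rfl, by rw [hw]; rfl, by rw [hw]; rfl, ?_, fun w' hop hloc hlt => ?_⟩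
      · rw [hw]
        simp only [Node.rank]
        split_ifs <;> simp [Node.lex_lt_iff] at *
      · rw [hw]
        have := i.2
        rcases hn' : node w' with ⟨i', b', p'⟩ | ⟨i', b'⟩ | ⟨i', b', j', q'⟩ | j' | ⟨i', s'⟩ <;>
          rw [hn'] at hop hloc hlt
        · have := i'.2
          fin_cases p' <;> simp [Node.lab, sLoc, vLoc] at hloc
          · omega
          · omega
          · obtain rfl := Fin.ext hloc
            simp only [Node.rank] at *
            split_ifs at * <;> simp [Node.lex_lt_iff, Node.lex_le_iff] at *
        · cases hop
        · simp [Node.lab, vLoc, cLoc] at hloc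
          omega
        · cases hop
        · fin_cases s' <;> cases hop
    · cases hr
    · have hC := hA (φ.clauses.get j) (List.get_mem _ _)
      obtain ⟨p, hp⟩ := hC
      obtain ⟨w, q, hw⟩ := exists_node_eq_litWrite
        (i := (φ.clauses.get j p).1) (b := (φ.clauses.get j p).2) (j := j) ⟨p, rfl⟩
      -- Several literals may write `c_j`, all with value 1, so the latest of those writes serves.
      -- There is one before the read because a true literal of the clause writes in stage 1.
      obtain ⟨w', ⟨h1, h2, h3⟩, hmax⟩ := Set.exists_max_image
        {w | (node w).lab.op = OpKind.write ∧ (node w).lab.loc = φ.cLoc j ∧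
          (node w).rank A < (Node.clauseRead j).rank A} (fun e => (node e).rank A)
        (Set.toFinite _) ⟨w, by rw [Set.mem_ofPred, hw]; exact ⟨rfl, rfl, by
          simp only [Node.rank, hp, if_true]
          rw [Node.lex_lt_iff]
          omega⟩⟩
      refine ⟨w', h1, h2, ?_, h3, fun w'' hop hloc hlt => hmax w'' ⟨hop, hloc, hlt⟩⟩
      rcases hn' : node w' with ⟨i', b', p'⟩ | ⟨i', b'⟩ | ⟨i', b', j', q'⟩ | j' | ⟨i', s'⟩ <;>
        rw [hn'] at h1 h2
      · have := i'.2
        fin_cases p' <;> simp [Node.lab, sLoc, vLoc, cLoc] at h2 <;> omega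
      · cases h1
      · rfl
      · cases h1
      · fin_cases s' <;> cases h1
    -- The read `r(s_i, 2)` sees stage 0, and `r(s_i, 1)` sees the first write of the other thread,
    -- inserted just before it.
    · obtain ⟨w, hw⟩ : ∃ w : φ.toExec.Ev, node w = if s = 0 then .val i (A i) 1 else
          .val i (!A i) 0 := by
        split_ifs <;> exact exists_node_eq_val _ _ _
      have := i.2
      refine ⟨w, ?_, ?_, ?_, ?_, fun w' hop hloc hlt => ?_⟩
      · rw [hw]; fin_cases s <;> rfl
      · rw [hw]; fin_cases s <;> rfl
      · rw [hw]; fin_cases s <;> rfl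
      · rw [hw]
        fin_cases s <;> simp [Node.rank, Node.lex_lt_iff]
      · rw [hw]
        rcases hn' : node w' with ⟨i', b', p'⟩ | ⟨i', b'⟩ | ⟨i', b', j', q'⟩ | j' | ⟨i', s'⟩ <;>
          rw [hn'] at hop hloc hlt
        · have := i'.2
          have hi : i = i' ∧ p' ≠ 2 := by
            fin_cases p' <;> fin_cases s <;> simp [Node.lab, sLoc, vLoc] at hloc ⊢ <;> omega
          obtain ⟨rfl, hp'⟩ := hi
          by_cases hb : b' = A i
          · subst hb
            fin_cases s <;> fin_cases p' <;> simp [Node.rank, Node.lex_lt_iff, Node.lex_le_iff] at *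
          · obtain rfl : b' = !A i := by
              revert hb; cases b' <;> cases A i <;> simp
            fin_cases s <;> fin_cases p' <;> simp [Node.rank, Node.lex_lt_iff] at *
        · cases hop
        · fin_cases s <;> simp [Node.lab, sLoc, cLoc] at hloc <;> omega
        · cases hop
        · fin_cases s' <;> cases hop

/-- Let `B i` name the value thread that serves `r(s_i, 1)`. The negation of `B` satisfies each
clause at the literal whose thread serves `r(c_j, 1)`. -/
theorem satisfiable_of_consistent_WRA (h : φ.toExec.Consistent MemModel.WRA) :
    φ.Satisfiable := by
  obtain ⟨G, -, hcoh⟩ := h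
  have hlab : ∀ w r, G.rf w r → (node w).lab.op = OpKind.write ∧
      (node w).lab.loc = (node r).lab.loc ∧ (node w).lab.val = (node r).lab.val := by
    intro w r h
    have := G.rf_spec w r h
    simp only [lab_node]
    exact ⟨this.1, this.2.2⟩
  have hex : ∀ r, (node r).lab.op = OpKind.read → ∃ w, G.rf w r := fun r hr =>
    (G.rf_existsUnique r (by rwa [← lab_node])).exists
  have hpo : ∀ a b : φ.toExec.Ev, (node a).tid = (node b).tid → (node a).pos < (node b).pos →
      G.hb a b := by
    intro a b h h'
    rw [tid_node, tid_node] at h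
    rw [pos_node, pos_node] at h'
    exact .single (Or.inl ⟨Fin.ext h, h'⟩)
  have hs : ∀ i : Fin φ.numVars, ∃ b, ∃ w r, G.rf w r ∧ node w = .val i b 0 ∧
      node r = .varRead i 1 := by
    intro i
    obtain ⟨r, hr⟩ := exists_node_eq_varRead i 1
    obtain ⟨w, hw⟩ := hex r (by rw [hr]; rfl)
    obtain ⟨h1, h2, h3⟩ := hlab w r hw
    rw [hr] at h2 h3
    have := i.2
    rcases hn : node w with ⟨i', b', p'⟩ | ⟨i', b'⟩ | ⟨i', b', j', q'⟩ | j' | ⟨i', s'⟩ <;>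
      rw [hn] at h1 h2 h3
    · refine ⟨b', w, r, hw, ?_, hr⟩
      rw [hn]
      fin_cases p' <;> simp [Node.lab, sLoc, vLoc] at h2 h3 ⊢
      · exact Fin.ext h2
      · omega
    · cases h1
    · simp [Node.lab, sLoc, cLoc] at h2
      omega
    · cases h1
    · fin_cases s' <;> cases h1
  choose B hB using hs
  refine ⟨fun i => !B i, fun C hC => ?_⟩
  obtain ⟨j, rfl⟩ := List.get_of_mem hC
  obtain ⟨rc, hrc⟩ := exists_node_eq_clauseRead j
  obtain ⟨wc, hwc⟩ := hex rc (by rw [hrc]; rfl)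
  obtain ⟨i, b, q, hn, p, hp⟩ : ∃ i b q, node wc = .litWrite i b j q ∧
      ∃ p : Fin 3, φ.clauses.get j p = (i, b) := by
    obtain ⟨h1, h2, -⟩ := hlab wc rc hwc
    have hv := node_valid wc
    rw [hrc] at h2
    rcases hn : node wc with ⟨i', b', p'⟩ | ⟨i', b'⟩ | ⟨i', b', j', q'⟩ | j' | ⟨i', s'⟩ <;>
      rw [hn] at h1 h2 hv
    · have := i'.2
      fin_cases p' <;> simp [Node.lab, sLoc, vLoc, cLoc] at h2 <;> omega
    · cases h1
    · simp only [Node.lab, cLoc_inj] at h2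
      subst h2
      exact ⟨i', b', q', rfl, hv⟩
    · cases h1
    · fin_cases s' <;> cases h1
  refine ⟨p, ?_⟩
  rw [hp]
  by_contra hb
  obtain rfl : b = B i := by
    cases b <;> cases h : B i <;> simp_all
  obtain ⟨rl, hrl⟩ := exists_node_eq_litRead i (B i)
  obtain ⟨wv, hwv⟩ := hex rl (by rw [hrl]; rfl)
  have hnv : node wv = .val i (B i) 2 := by
    obtain ⟨h1, h2, h3⟩ := hlab wv rl hwv
    rw [hrl] at h2 h3
    have := i.2
    rcases hn : node wv with ⟨i', b', p'⟩ | ⟨i', b'⟩ | ⟨i', b', j', q'⟩ | j' | ⟨i', s'⟩ <;>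
      rw [hn] at h1 h2 h3
    · have := i'.2
      fin_cases p' <;> simp [Node.lab, sLoc, vLoc] at h2 h3 ⊢
      · omega
      · omega
      · refine ⟨Fin.ext h2, ?_⟩
        revert h3
        cases b' <;> cases B i <;> simp
    · cases h1
    · simp [Node.lab, vLoc, cLoc] at h2
      omega
    · cases h1
    · fin_cases s' <;> cases h1
  obtain ⟨w, r, hwr, hw, hr⟩ := hB i
  obtain ⟨w', hw'⟩ := exists_node_eq_val i (B i) 1
  refine hcoh w w' r hwr (by rw [← lab_node, hw']; rfl)
    (by rw [← lab_node, ← lab_node, hw', hr]; rfl)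
    (hpo _ _ (by rw [hw, hw']; rfl) (by rw [hw, hw']; simp [Node.pos])) ?_
  have e1 : G.hb w' wv := hpo _ _ (by rw [hw', hnv]; rfl) (by rw [hw', hnv]; simp [Node.pos])
  have e2 : G.hb rl wc := hpo _ _ (by rw [hrl, hn]; rfl) (by rw [hrl, hn]; simp [Node.pos])
  have e3 : G.hb rc r := hpo _ _ (by rw [hrc, hr]; rfl) (by
    rw [hrc, hr]; simp only [Node.pos]; have := j.2; omega)
  -- The forbidden path: `w(s_i, 2)`, `w(v_i, b)`, `r(v_i, b)`, `w(c_j, 1)`, `r(c_j, 1)`, `r(s_i,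
  -- 1)` with `b = B i`, alternating between `po` and `rf`.
  exact (((e1.tail (Or.inr hwv)).trans e2).tail (Or.inr hwc)).trans e3

theorem consistent_iff_satisfiable (φ : Formula3) (M : MemModel) :
    φ.toExec.Consistent M ↔ φ.Satisfiable := by
  constructor
  · intro h
    cases M with
    | RA => exact satisfiable_of_consistent_WRA h.WRA_of_RA
    | SRA => exact satisfiable_of_consistent_WRA h.RA_of_SRA.WRA_of_RA
    | WRA => exact satisfiable_of_consistent_WRA h
  · intro h
    have h := consistent_SRA_of_satisfiable h
    cases M with
    | RA => exact h.RA_of_SRA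
    | SRA => exact h
    | WRA => exact h.RA_of_SRA.WRA_of_RA

end Formula3

/-! ### Size, names and writers of the constructed execution -/

theorem PartialExec.numEvents_append (X Y : PartialExec) :
    PartialExec.numEvents (X ++ Y) = X.numEvents + Y.numEvents := by
  simp [numEvents]

theorem PartialExec.numEvents_flatMap_le {α : Type*} {f : α → PartialExec} {d : ℕ}
    (hf : ∀ a, (f a).numEvents ≤ d) (l : List α) :
    PartialExec.numEvents (l.flatMap f) ≤ d * l.length := by
  induction l with
  | nil => simp [numEvents]
  | cons a l ih =>
    rw [List.flatMap_cons, numEvents_append, List.length_cons, mul_add]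
    have := hf a
    omega

theorem PartialExec.le_numEvents_flatMap {α : Type*} {f : α → PartialExec} {d : ℕ}
    (hf : ∀ a, d ≤ (f a).numEvents) (l : List α) :
    d * l.length ≤ PartialExec.numEvents (l.flatMap f) := by
  induction l with
  | nil => simp
  | cons a l ih =>
    rw [List.flatMap_cons, numEvents_append, List.length_cons, mul_add]
    have := hf a
    omega

namespace Formula3

variable (φ : Formula3)

theorem length_litThread_le (l : Lit φ.numVars) :
    (φ.litThread l).length ≤ φ.clauses.length + 1 := by
  simp only [litThread, List.length_cons, List.length_map, add_le_add_iff_right]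
  exact (List.length_filter_le _ _).trans (by simp)

/-- Per variable there are six writes in the value threads, two reads that open the literal threads,
and at most one write per literal and clause. -/
theorem numEvents_toExec_le : φ.toExec.numEvents ≤
    (8 + 2 * φ.clauses.length) * φ.numVars + (φ.clauses.length + 2 * φ.numVars) := by
  rw [toExec, PartialExec.numEvents_append]
  refine Nat.add_le_add ((PartialExec.numEvents_flatMap_le
    (d := 8 + 2 * φ.clauses.length) (fun i => ?_) _).trans (by simp)) ?_
  · have h1 := φ.length_litThread_le (i, true)
    have h2 := φ.length_litThread_le (i, false)
    simp only [PartialExec.numEvents, List.map_cons, List.sum_cons, List.map_nil, List.sum_nil,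
      valueThread, List.length_cons, List.length_nil]
    omega
  · simp [PartialExec.numEvents, length_finalThread]

/-- Even without the writes of the literal threads there are enough events to name all `2k + m`
locations, where `m` is the number of clauses. -/
theorem le_numEvents_toExec :
    8 * φ.numVars + (φ.clauses.length + 2 * φ.numVars) ≤ φ.toExec.numEvents := by
  rw [toExec, PartialExec.numEvents_append]
  refine Nat.add_le_add (le_trans (by simp) (PartialExec.le_numEvents_flatMap
    (d := 8) (fun i => ?_) _)) ?_
  · simp only [PartialExec.numEvents, List.map_cons, List.sum_cons, List.map_nil, List.sum_nil,
      valueThread, List.length_cons, List.length_nil, litThread]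
    omega
  · simp [PartialExec.numEvents, length_finalThread]

theorem numThreads_toExec : φ.toExec.numThreads = 4 * φ.numVars + 1 := φ.length_toExec

theorem hasSmallNames_toExec : φ.toExec.HasSmallNames := by
  intro T hT e he
  obtain ⟨t, ht⟩ := List.mem_iff_getElem?.1 hT
  obtain ⟨p, hp⟩ := List.mem_iff_getElem?.1 he
  obtain ⟨n, -, -, -, rfl⟩ := exists_node_of_getElem? ht hp
  have hle := φ.le_numEvents_toExec
  rcases n with ⟨i, b, p⟩ | ⟨i, b⟩ | ⟨i, b, j, q⟩ | j | ⟨i, r⟩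
  · have := i.2
    have := b.toNat_le
    fin_cases p <;> simp only [Node.lab, sLoc, vLoc] <;> omega
  · have := i.2
    have := b.toNat_le
    simp only [Node.lab, vLoc]; omega
  · have := i.2
    have := j.2
    simp only [Node.lab, cLoc]; omega
  -- A clause has a literal, so there is a variable and hence more than one event, as the value 1
  -- requires.
  · have := (φ.clauses.get j 0).1.2
    have := j.2
    simp only [Node.lab, cLoc]; omega
  · have := i.2
    fin_cases r <;> simp only [Node.lab, sLoc] <;> omega

/-- Only the two value threads of variable `i` write `s_i` and `v_i`. Only threads of literals in
the clause write `c_j`, and it has at most three. -/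
theorem isWriterBounded_toExec : φ.toExec.IsWriterBounded 3 := by
  intro x
  suffices h : ∃ S : Finset ℕ, S.card ≤ 3 ∧ ∀ t ∈ φ.toExec.writers x, (t : ℕ) ∈ S by
    obtain ⟨S, hS, h⟩ := h
    rw [← Set.ncard_image_of_injective _ Fin.val_injective]
    refine le_trans (Set.ncard_le_ncard (t := (S : Set ℕ)) ?_ S.finite_toSet) ?_
    · rintro _ ⟨t, ht, rfl⟩
      exact h t ht
    · rwa [Set.ncard_coe_finset]
  have hnode : ∀ t ∈ φ.toExec.writers x, ∃ n : φ.Node, n.Valid ∧ n.tid = t ∧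
      n.lab.op = OpKind.write ∧ n.lab.loc = x := by
    rintro t ⟨e, he, h1, h2⟩
    obtain ⟨p, hp⟩ := List.mem_iff_getElem?.1 he
    obtain ⟨n, h3, h4, -, rfl⟩ := exists_node_of_getElem? (φ := φ) (t := t) (by simp) hp
    exact ⟨n, h3, h4, h1, h2⟩
  rcases Nat.lt_or_ge x (2 * φ.numVars) with hx | hx
  · obtain ⟨i, hi⟩ : ∃ i : Fin φ.numVars, x = φ.sLoc i ∨ x = φ.vLoc i := by
      rcases Nat.lt_or_ge x φ.numVars with h | h
      · exact ⟨⟨x, h⟩, Or.inl rfl⟩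
      · exact ⟨⟨x - φ.numVars, by omega⟩, Or.inr (by simp only [vLoc]; omega)⟩
    refine ⟨{φ.valIdx i true, φ.valIdx i false}, Finset.card_le_two.trans (by norm_num), ?_⟩
    intro t ht
    obtain ⟨n, hv, rt, hop, hloc⟩ := hnode t ht
    rw [← rt]
    rcases n with ⟨i', b, p⟩ | ⟨i', b⟩ | ⟨i', b, j, q⟩ | j | ⟨i', r⟩
    · obtain rfl : i = i' := by
        have := i.2
        have := i'.2
        fin_cases p <;> simp only [Node.lab, sLoc, vLoc] at hloc hi <;> omega
      cases b <;> simp [Node.tid]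
    · cases hop
    · simp only [Node.lab, cLoc] at hloc
      omega
    · cases hop
    · fin_cases r <;> cases hop
  · rcases Nat.lt_or_ge x (2 * φ.numVars + φ.clauses.length) with hx' | hx'
    · obtain ⟨j, hj⟩ : ∃ j : Fin φ.clauses.length, x = φ.cLoc j :=
        ⟨⟨x - 2 * φ.numVars, by omega⟩, by simp only [cLoc]; omega⟩
      refine ⟨Finset.univ.image fun p : Fin 3 =>
        φ.litIdx (φ.clauses.get j p).1 (φ.clauses.get j p).2, Finset.card_image_le, ?_⟩
      intro t ht
      obtain ⟨n, hv, rt, hop, hloc⟩ := hnode t ht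
      rw [← rt]
      rcases n with ⟨i', b, p⟩ | ⟨i', b⟩ | ⟨i', b, j', q⟩ | j' | ⟨i', r⟩
      · have := i'.2
        fin_cases p <;> simp only [Node.lab, sLoc, vLoc] at hloc <;> omega
      · cases hop
      · obtain ⟨p, hp⟩ := hv
        rw [hj] at hloc
        simp only [Node.lab, cLoc_inj] at hloc
        subst hloc
        exact Finset.mem_image.2 ⟨p, Finset.mem_univ _, by rw [hp]; rfl⟩
      · cases hop
      · fin_cases r <;> cases hop
    · refine ⟨∅, by simp, ?_⟩
      intro t ht
      obtain ⟨n, hv, rt, hop, hloc⟩ := hnode t ht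
      exfalso
      rcases n with ⟨i', b, p⟩ | ⟨i', b⟩ | ⟨i', b, j', q⟩ | j' | ⟨i', r⟩
      · have := i'.2
        fin_cases p <;> simp only [Node.lab, sLoc, vLoc] at hloc <;> omega
      · cases hop
      · have := j'.2
        simp only [Node.lab, cLoc] at hloc
        omega
      · cases hop
      · fin_cases r <;> cases hop

end Formula3

theorem MemEvent.length_encode (e : MemEvent) : e.encode.length = e.loc + e.val + 2 := by
  simp [MemEvent.encode]
  omega

namespace PartialExec

/-- The size of the encoding is polynomial in the numbers of threads and events. -/
theorem HasSmallNames.length_encode_le {X : PartialExec} (h : X.HasSmallNames) :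
    X.encode.length ≤ X.numEvents * (2 * X.numEvents + 2) + X.numThreads := by
  -- The bound on names is detached from the execution, which shrinks in the induction.
  have key : ∀ (N : ℕ) (Y : PartialExec), (∀ T ∈ Y, ∀ e ∈ T, e.loc < N ∧ e.val < N) →
      Y.encode.length ≤ Y.numEvents * (2 * N + 2) + Y.numThreads := by
    intro N Y hY
    induction Y with
    | nil => simp [encode]
    | cons T Y ih =>
      have ih := ih fun T hT => hY T (List.mem_cons_of_mem _ hT)
      have hT : (List.flatMap MemEvent.encode T).length ≤ T.length * (2 * N + 2) := by
        have hT := hY T List.mem_cons_self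
        clear ih hY
        induction T with
        | nil => simp
        | cons e T ih =>
          have := ih fun e he => hT e (List.mem_cons_of_mem _ he)
          have he := hT e List.mem_cons_self
          rw [List.flatMap_cons, List.length_append, MemEvent.length_encode, List.length_cons,
            add_mul]
          omega
      simp only [encode, numEvents, numThreads, List.flatMap_cons, List.length_append,
        List.length_cons, List.length_nil, List.map_cons, List.sum_cons, add_mul] at ih ⊢
      omega
  exact key _ X h

end PartialExec

/-! ### Counting the steps of stack machines -/

/-- The stack machine `M` gets from `c` to `d` in exactly `n` steps. -/
def StepsTo {K : Type*} {Γ : K → Type*} {Λ σ : Type*} [DecidableEq K]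
    (M : Λ → TM2.Stmt Γ Λ σ) (n : ℕ) (c d : TM2.Cfg Γ Λ σ) : Prop :=
  (flip Bind.bind (TM2.step M))^[n] (some c) = some d

namespace StepsTo

variable {K : Type*} {Γ : K → Type*} {Λ σ : Type*} [DecidableEq K]
  {M : Λ → TM2.Stmt Γ Λ σ} {m n : ℕ} {c d e : TM2.Cfg Γ Λ σ}

theorem trans (h : StepsTo M m c d) (h' : StepsTo M n d e) : StepsTo M (m + n) c e := by
  unfold StepsTo at *
  rw [Nat.add_comm, Function.iterate_add_apply, h, h']

theorem single {l : Λ} {v : σ} {S : ∀ k, List (Γ k)} :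
    StepsTo M 1 ⟨some l, v, S⟩ (TM2.stepAux (M l) v S) := rfl

theorem refl : StepsTo M 0 c c := rfl

theorem cases_succ (h : StepsTo M (n + 1) c e) : ∃ d, TM2.step M c = some d ∧ StepsTo M n d e := by
  unfold StepsTo at h
  rw [Function.iterate_succ_apply] at h
  rcases hc : TM2.step M c with _ | d
  · have h0 : ∀ n, (flip Bind.bind (TM2.step M))^[n] none = none := fun n =>
      Function.iterate_fixed rfl n
    rw [show flip Bind.bind (TM2.step M) (some c) = none from hc, h0] at h
    cases h
  · exact ⟨d, rfl, by rwa [show flip Bind.bind (TM2.step M) (some c) = some d from hc] at h⟩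

theorem cons {l : Λ} {v : σ} {S : ∀ k, List (Γ k)}
    (h : StepsTo M n (TM2.stepAux (M l) v S) e) : StepsTo M (n + 1) ⟨some l, v, S⟩ e := by
  rw [Nat.add_comm]
  exact single.trans h

end StepsTo

theorem Turing.initList_stk (tm : FinTM2) (s : List (tm.Γ tm.k₀)) :
    (initList tm s).stk = Function.update (fun _ => []) tm.k₀ s := by
  funext k
  by_cases h : k = tm.k₀
  · subst h
    simp [initList]
  · simp [initList, h]

theorem Turing.haltList_stk (tm : FinTM2) (s : List (tm.Γ tm.k₁)) :
    (haltList tm s).stk = Function.update (fun _ => []) tm.k₁ s := by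
  funext k
  by_cases h : k = tm.k₁
  · subst h
    simp [haltList]
  · simp [haltList, h]

/-- An output requires that the machine is back in its initial state, with every stack empty except
the output stack. Composition relies on this, and the reduction must clean up for it. -/
theorem Turing.nonempty_outputsInTime_iff {tm : FinTM2} {l : List (tm.Γ tm.k₀)}
    {l' : List (tm.Γ tm.k₁)} {m : ℕ} : Nonempty (TM2OutputsInTime tm l (some l') m) ↔
      ∃ n ≤ m, StepsTo tm.m n
        ⟨some tm.main, tm.initialState, Function.update (fun _ => []) tm.k₀ l⟩
        ⟨none, tm.initialState, Function.update (fun _ => []) tm.k₁ l'⟩ := by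
  rw [← initList_stk, ← haltList_stk]
  constructor
  · rintro ⟨⟨n, h⟩, hn⟩
    exact ⟨n, hn, h⟩
  · rintro ⟨n, hn, h⟩
    exact ⟨⟨n, h⟩, hn⟩

theorem Turing.nonempty_outputsInTime_congr {tm : FinTM2} {l₁ l₂ : List (tm.Γ tm.k₀)}
    {l₁' l₂' : List (tm.Γ tm.k₁)} {m n : ℕ} (h : Nonempty (TM2OutputsInTime tm l₁ (some l₁') m))
    (hl : l₂ = l₁) (hl' : l₂' = l₁') (hmn : m ≤ n) :
    Nonempty (TM2OutputsInTime tm l₂ (some l₂') n) := by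
  subst hl hl'
  obtain ⟨t, ht, h⟩ := nonempty_outputsInTime_iff.1 h
  exact nonempty_outputsInTime_iff.2 ⟨t, ht.trans hmn, h⟩

/-! ### A language of while-programs over stacks -/

/-- Programs that manipulate finitely many stacks, and test the tops of stacks. -/
inductive StackProg {K : Type} (Γ : K → Type) : Type
  | skip
  | push (k : K) (a : Γ k)
  | pop (k : K)
  | seq (p q : StackProg Γ)
  | ite (k : K) (P : Option (Γ k) → Bool) (p q : StackProg Γ)
  | loop (k : K) (P : Option (Γ k) → Bool) (p : StackProg Γ)

namespace StackProg

variable {K : Type} {Γ : K → Type}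

/-- The control points of a program. -/
def Label : StackProg Γ → Type
  | skip => Unit
  | push _ _ => Unit
  | pop _ => Unit
  | seq p q => p.Label ⊕ q.Label
  | ite _ _ p q => Option (p.Label ⊕ q.Label)
  | loop _ _ p => Option p.Label

/-- There are finitely many control points. -/
@[reducible]
def fintypeLabel : ∀ p : StackProg Γ, Fintype p.Label
  | skip => inferInstanceAs (Fintype Unit)
  | push _ _ => inferInstanceAs (Fintype Unit)
  | pop _ => inferInstanceAs (Fintype Unit)
  | seq p q =>
    have := p.fintypeLabel
    have := q.fintypeLabel
    inferInstanceAs (Fintype (p.Label ⊕ q.Label))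
  | ite _ _ p q =>
    have := p.fintypeLabel
    have := q.fintypeLabel
    inferInstanceAs (Fintype (Option (p.Label ⊕ q.Label)))
  | loop _ _ p =>
    have := p.fintypeLabel
    inferInstanceAs (Fintype (Option p.Label))

/-- The first control point. -/
def entry : ∀ p : StackProg Γ, p.Label
  | skip => ()
  | push _ _ => ()
  | pop _ => ()
  | seq p _ => Sum.inl p.entry
  | ite _ _ _ _ => none
  | loop _ _ _ => none

/-- The statement that tests the top of a stack and jumps accordingly. -/
def testStmt {Λ : Type} (k : K) (P : Option (Γ k) → Bool) (l l' : Λ) : TM2.Stmt Γ Λ Bool :=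
  .peek k (fun _ o => P o) (.branch id (.load (fun _ => false) (.goto fun _ => l))
    (.load (fun _ => false) (.goto fun _ => l')))

/-- The stack machine code of a program inside a machine with labels `Λ`: the control points are
placed by `emb`, and the program is left to `exit`. -/
def code {Λ : Type} : ∀ (p : StackProg Γ) (_ : p.Label → Λ) (_ : Λ), p.Label → TM2.Stmt Γ Λ Bool
  | skip, _, exit => fun _ => .goto fun _ => exit
  | push k a, _, exit => fun _ => .push k (fun _ => a) (.goto fun _ => exit)
  | pop k, _, exit => fun _ => .pop k (fun v _ => v) (.goto fun _ => exit)
  | seq p q, emb, exit => fun x => match x with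
    | Sum.inl x => p.code (fun y => emb (Sum.inl y)) (emb (Sum.inr q.entry)) x
    | Sum.inr x => q.code (fun y => emb (Sum.inr y)) exit x
  | ite k P p q, emb, exit => fun x => match x with
    | none => testStmt k P (emb (some (Sum.inl p.entry))) (emb (some (Sum.inr q.entry)))
    | some (Sum.inl x) => p.code (fun y => emb (some (Sum.inl y))) exit x
    | some (Sum.inr x) => q.code (fun y => emb (some (Sum.inr y))) exit x
  | loop k P p, emb, exit => fun x => match x with
    | none => testStmt k P (emb (some p.entry)) exit
    | some x => p.code (fun y => emb (some y)) (emb none) x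

variable [DecidableEq K]

/-- Executions of programs, with their number of steps. -/
inductive Run : StackProg Γ → (∀ k, List (Γ k)) → (∀ k, List (Γ k)) → ℕ → Prop
  | skip {S} : Run skip S S 1
  | push {S k a} : Run (push k a) S (Function.update S k (a :: S k)) 1
  | pop {S k} : Run (pop k) S (Function.update S k (S k).tail) 1
  | seq {p q S T U m n} : Run p S T m → Run q T U n → Run (seq p q) S U (m + n)
  | ite_true {k P p q S T n} : P (S k).head? = true → Run p S T n → Run (ite k P p q) S T (n + 1)
  | ite_false {k P p q S T n} : P (S k).head? = false → Run q S T n → Run (ite k P p q) S T (n + 1)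
  | loop_true {k P p S T U m n} : P (S k).head? = true → Run p S T m → Run (loop k P p) T U n →
      Run (loop k P p) S U (m + n + 1)
  | loop_false {k P p S} : P (S k).head? = false → Run (loop k P p) S S 1

theorem stepsTo_testStmt {Λ : Type} {M : Λ → TM2.Stmt Γ Λ Bool} {l l₁ l₂ : Λ} {k : K}
    {P : Option (Γ k) → Bool} (h : M l = testStmt k P l₁ l₂) (S : ∀ k, List (Γ k)) :
    StepsTo M 1 ⟨some l, false, S⟩ ⟨some (if P (S k).head? then l₁ else l₂), false, S⟩ := by
  refine StepsTo.cons (n := 0) ?_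
  rw [h]
  simp only [testStmt, TM2.stepAux, id]
  cases P (S k).head? <;> exact StepsTo.refl

/-- The Boolean state carries the outcome of a test only within one machine step and is `false` at
every control point. A sequence leads directly into its second part, and a loop body exits to the
test, so the costs of `Run` are exact. -/
theorem Run.stepsTo {p : StackProg Γ} {S T : ∀ k, List (Γ k)} {n : ℕ} (h : Run p S T n) {Λ : Type}
    (M : Λ → TM2.Stmt Γ Λ Bool) (emb : p.Label → Λ) (exit : Λ)
    (hM : ∀ x, M (emb x) = p.code emb exit x) :
    StepsTo M n ⟨some (emb p.entry), false, S⟩ ⟨some exit, false, T⟩ := by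
  induction h generalizing exit with
  | skip => exact StepsTo.cons (by rw [hM]; exact StepsTo.refl)
  | push => exact StepsTo.cons (by rw [hM]; exact StepsTo.refl)
  | pop => exact StepsTo.cons (by rw [hM]; exact StepsTo.refl)
  | seq _ _ ih ih' =>
    exact (ih (fun y => emb (Sum.inl y)) _ fun x => hM (Sum.inl x)).trans
      (ih' (fun y => emb (Sum.inr y)) _ fun x => hM (Sum.inr x))
  | ite_true hP _ ih =>
    rw [Nat.add_comm]
    refine (stepsTo_testStmt (hM none) _).trans ?_
    rw [hP]
    exact ih (fun y => emb (some (Sum.inl y))) _ fun x => hM (some (Sum.inl x))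
  | ite_false hP _ ih =>
    rw [Nat.add_comm]
    refine (stepsTo_testStmt (hM none) _).trans ?_
    rw [hP]
    exact ih (fun y => emb (some (Sum.inr y))) _ fun x => hM (some (Sum.inr x))
  | loop_true hP _ _ ih ih' =>
    rw [Nat.add_comm]
    refine (stepsTo_testStmt (hM none) _).trans ?_
    rw [hP]
    exact (ih (fun y => emb (some y)) _ fun x => hM (some x)).trans (ih' emb exit hM)
  | @loop_false k P p S hP =>
    have h := stepsTo_testStmt (hM none) S
    rw [hP] at h
    exact h

/-- The machine that runs a program. -/
def toTM2 [Fintype K] (p : StackProg Γ) (k₀ k₁ : K) [Fintype (Γ k₀)] : FinTM2 :=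
  have := p.fintypeLabel
  { K := K
    k₀ := k₀
    k₁ := k₁
    Γ := Γ
    Λ := Option p.Label
    main := some p.entry
    σ := Bool
    initialState := false
    m := fun x => match x with
      | none => .halt
      | some x => p.code some none x }

/-- The program `p` gets from `S` to `T` in at most `n` steps. -/
def RunsIn (p : StackProg Γ) (S T : ∀ k, List (Γ k)) (n : ℕ) : Prop := ∃ m ≤ n, Run p S T m

/-- The additional step executes the `halt` at the exit label `none`. -/
theorem RunsIn.outputsInTime [Fintype K] {p : StackProg Γ} {k₀ k₁ : K} [Fintype (Γ k₀)]
    {l : List (Γ k₀)} {l' : List (Γ k₁)} {n : ℕ}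
    (h : RunsIn p (Function.update (fun _ => []) k₀ l) (Function.update (fun _ => []) k₁ l') n) :
    Nonempty (TM2OutputsInTime (p.toTM2 k₀ k₁) l (some l') (n + 1)) := by
  obtain ⟨m, hm, h⟩ := h
  exact nonempty_outputsInTime_iff.2 ⟨m + 1, by omega,
    (h.stepsTo (p.toTM2 k₀ k₁).m some none fun _ => rfl).trans StepsTo.single⟩

namespace RunsIn

variable {p q : StackProg Γ} {S T U : ∀ k, List (Γ k)} {m n : ℕ} {k : K}
  {P : Option (Γ k) → Bool}

theorem mono (h : RunsIn p S T m) (hmn : m ≤ n) : RunsIn p S T n :=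
  let ⟨t, ht, h⟩ := h
  ⟨t, ht.trans hmn, h⟩

theorem skip : RunsIn (.skip : StackProg Γ) S S 1 := ⟨1, le_rfl, .skip⟩

theorem push {a : Γ k} : RunsIn (.push k a) S (Function.update S k (a :: S k)) 1 :=
  ⟨1, le_rfl, .push⟩

theorem pop : RunsIn (.pop k) S (Function.update S k (S k).tail) 1 := ⟨1, le_rfl, .pop⟩

theorem seq (h : RunsIn p S T m) (h' : RunsIn q T U n) : RunsIn (.seq p q) S U (m + n) :=
  let ⟨_, ht, h⟩ := h
  let ⟨_, ht', h'⟩ := h'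
  ⟨_, Nat.add_le_add ht ht', .seq h h'⟩

theorem ite_true (hP : P (S k).head? = true) (h : RunsIn p S T n) :
    RunsIn (.ite k P p q) S T (n + 1) :=
  let ⟨_, ht, h⟩ := h
  ⟨_, Nat.add_le_add_right ht 1, .ite_true hP h⟩

theorem ite_false (hP : P (S k).head? = false) (h : RunsIn q S T n) :
    RunsIn (.ite k P p q) S T (n + 1) :=
  let ⟨_, ht, h⟩ := h
  ⟨_, Nat.add_le_add_right ht 1, .ite_false hP h⟩

theorem loop_false (hP : P (S k).head? = false) : RunsIn (.loop k P p) S S 1 :=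
  ⟨1, le_rfl, .loop_false hP⟩

theorem loop_true (hP : P (S k).head? = true) (h : RunsIn p S T m)
    (h' : RunsIn (.loop k P p) T U n) : RunsIn (.loop k P p) S U (m + n + 1) :=
  let ⟨_, ht, h⟩ := h
  let ⟨_, ht', h'⟩ := h'
  ⟨_, Nat.add_le_add_right (Nat.add_le_add ht ht') 1, .loop_true hP h h'⟩

/-- The rule for loops, given the states `F 0, …, F n` at the tests. -/
theorem loop (F : ℕ → ∀ k, List (Γ k)) (B : ℕ) (hP : ∀ i < n, P (F i k).head? = true)
    (hn : P (F n k).head? = false) (h : ∀ i < n, RunsIn p (F i) (F (i + 1)) B) :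
    RunsIn (.loop k P p) (F 0) (F n) (n * (B + 1) + 1) := by
  induction n generalizing F with
  | zero => simpa using loop_false (p := p) hn
  | succ n ih =>
    refine (loop_true (hP 0 (by omega)) (h 0 (by omega)) (ih (fun i => F (i + 1))
      (fun i hi => hP (i + 1) (by omega)) hn fun i hi => h (i + 1) (by omega))).mono (le_of_eq ?_)
    ring

end RunsIn

end StackProg

/-! ### Composition of stack machines -/

namespace Turing.TM2.Stmt

variable {K K' : Type*} {Γ' : K' → Type*} {Λ Λ' σ σ' : Type*}

/-- Embeds a statement into a larger machine, with more stacks, labels and states; where the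
statement halts, the larger machine continues with `fin`. -/
def embed (ι : K → K') (get : σ' → σ) (set : σ' → σ → σ') (f : Λ → Λ') (fin : Stmt Γ' Λ' σ') :
    Stmt (fun k => Γ' (ι k)) Λ σ → Stmt Γ' Λ' σ'
  | push k g q => push (ι k) (fun v => g (get v)) (embed ι get set f fin q)
  | peek k g q => peek (ι k) (fun v o => set v (g (get v) o)) (embed ι get set f fin q)
  | pop k g q => pop (ι k) (fun v o => set v (g (get v) o)) (embed ι get set f fin q)
  | load g q => load (fun v => set v (g (get v))) (embed ι get set f fin q)
  | branch g q q' =>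
    branch (fun v => g (get v)) (embed ι get set f fin q) (embed ι get set f fin q')
  | goto g => goto fun v => f (g (get v))
  | halt => fin

variable [DecidableEq K] [DecidableEq K'] {ι : K → K'} (hι : Function.Injective ι)
  {get : σ' → σ} {set : σ' → σ → σ'} (hget : ∀ v s, get (set v s) = s)
  (hset : ∀ v s t, set (set v s) t = set v t)
  {f : Λ → Λ'} {fin : Stmt Γ' Λ' σ'}

/-- The configuration `c'` of the larger machine corresponds to `c`; outside of the smaller machine
it has the state `v₀` and the stacks `S₀`. -/
def Corresponds (ι : K → K') (set : σ' → σ → σ') (f : Λ → Λ') (fin : Stmt Γ' Λ' σ')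
    (v₀ : σ') (S₀ : ∀ k, List (Γ' k)) (c : Cfg (fun k => Γ' (ι k)) Λ σ) (c' : Cfg Γ' Λ' σ') :
    Prop :=
  ∃ S', (∀ k, S' (ι k) = c.stk k) ∧ (∀ j ∉ Set.range ι, S' j = S₀ j) ∧
    c' = match c.l with
      | some l => ⟨some (f l), set v₀ c.var, S'⟩
      | none => stepAux fin (set v₀ c.var) S'

include hι hget hset in
-- Injectivity of `ι` keeps updates of different stacks apart, and the laws for `get` and `set` let
-- the small state live inside the large one.
theorem corresponds_stepAux {v₀ : σ'} {S₀ : ∀ k, List (Γ' k)}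
    (q : Stmt (fun k => Γ' (ι k)) Λ σ) (v : σ) (S : ∀ k, List (Γ' (ι k)))
    (S' : ∀ k, List (Γ' k)) (hS : ∀ k, S' (ι k) = S k) (hS' : ∀ j ∉ Set.range ι, S' j = S₀ j) :
    Corresponds ι set f fin v₀ S₀ (stepAux q v S)
      (stepAux (embed ι get set f fin q) (set v₀ v) S') := by
  have hupd : ∀ (S : ∀ k, List (Γ' (ι k))) (S' : ∀ k, List (Γ' k)), (∀ k, S' (ι k) = S k) →
      (∀ j ∉ Set.range ι, S' j = S₀ j) → ∀ k x,
      (∀ k', Function.update S' (ι k) x (ι k') = Function.update S k x k') ∧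
      ∀ j ∉ Set.range ι, Function.update S' (ι k) x j = S₀ j := by
    refine fun S S' hS hS' k x => ⟨fun k' => ?_, fun j hj => ?_⟩
    · by_cases h : k' = k
      · subst h; simp
      · rw [Function.update_of_ne (hι.ne h), Function.update_of_ne h, hS]
    · rw [Function.update_of_ne (fun h => hj ⟨k, h.symm⟩), hS' j hj]
  induction q generalizing v S S' with
  | push k g q ih =>
    simp only [embed, stepAux, hget, hS]
    exact ih _ _ _ (hupd _ _ hS hS' k _).1 (hupd _ _ hS hS' k _).2
  | peek k g q ih =>
    simp only [embed, stepAux, hget, hS, hset]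
    exact ih _ _ _ hS hS'
  | pop k g q ih =>
    simp only [embed, stepAux, hget, hS, hset]
    exact ih _ _ _ (hupd _ _ hS hS' k _).1 (hupd _ _ hS hS' k _).2
  | load g q ih =>
    simp only [embed, stepAux, hget, hset]
    exact ih _ _ _ hS hS'
  | branch g q q' ih ih' =>
    simp only [embed, stepAux, hget]
    cases g v
    · exact ih' _ _ _ hS hS'
    · exact ih _ _ _ hS hS'
  | goto g => exact ⟨S', hS, hS', by simp only [embed, stepAux, hget]⟩
  | halt => exact ⟨S', hS, hS', rfl⟩

include hι hget hset in
-- Where the small machine halts, the large one performs `fin` in the same step, so the numbers of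
-- steps agree exactly.
theorem corresponds_of_stepsTo {M : Λ → Stmt (fun k => Γ' (ι k)) Λ σ} {M' : Λ' → Stmt Γ' Λ' σ'}
    (hM : ∀ l, M' (f l) = embed ι get set f fin (M l)) {v₀ : σ'} {S₀ : ∀ k, List (Γ' k)} {n : ℕ}
    {c d : Cfg (fun k => Γ' (ι k)) Λ σ} {c' : Cfg Γ' Λ' σ'} (h : StepsTo M n c d)
    (hc : Corresponds ι set f fin v₀ S₀ c c') :
    ∃ d', StepsTo M' n c' d' ∧ Corresponds ι set f fin v₀ S₀ d d' := by
  induction n generalizing c c' with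
  | zero =>
    obtain rfl : c = d := Option.some.inj h
    exact ⟨c', StepsTo.refl, hc⟩
  | succ n ih =>
    obtain ⟨e, he, h⟩ := h.cases_succ
    obtain ⟨l, v, S⟩ := c
    rcases l with _ | l
    · cases he
    · obtain ⟨S', hS, hS', rfl⟩ := hc
      obtain rfl : stepAux (M l) v S = e := Option.some.inj he
      obtain ⟨d', hd', hd⟩ := ih h
        (corresponds_stepAux (fin := fin) hι hget hset (M l) v S S' hS hS')
      refine ⟨d', StepsTo.cons ?_, hd⟩
      rwa [hM]

end Turing.TM2.Stmt

namespace Turing.FinTM2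

variable (tm₁ tm₂ : FinTM2)

/-- The alphabets of the composition: the stacks of both machines, and an auxiliary stack. -/
abbrev CompΓ : tm₁.K ⊕ tm₂.K ⊕ Unit → Type
  | Sum.inl k => tm₁.Γ k
  | Sum.inr (Sum.inl k) => tm₂.Γ k
  | Sum.inr (Sum.inr _) => tm₂.Γ tm₂.k₀

section joinStacks

variable {tm₁ tm₂}

/-- The stacks of the composition. -/
def joinStacks (S₁ : ∀ k, List (tm₁.Γ k)) (S₂ : ∀ k, List (tm₂.Γ k)) (l : List (tm₂.Γ tm₂.k₀)) :
    ∀ k, List (CompΓ tm₁ tm₂ k)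
  | Sum.inl k => S₁ k
  | Sum.inr (Sum.inl k) => S₂ k
  | Sum.inr (Sum.inr ()) => l

variable (S₁ : ∀ k, List (tm₁.Γ k)) (S₂ : ∀ k, List (tm₂.Γ k)) (l : List (tm₂.Γ tm₂.k₀))

theorem update_joinStacks_inl (k : tm₁.K) (x : List (tm₁.Γ k)) :
    Function.update (joinStacks S₁ S₂ l) (Sum.inl k) x =
      joinStacks (Function.update S₁ k x) S₂ l := by
  funext j
  rcases j with j | j | j
  · by_cases h : j = k
    · subst h; simp [joinStacks]
    · rw [Function.update_of_ne (by simpa using h)]; simp [joinStacks, h]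
  · rfl
  · rfl

theorem update_joinStacks_inr (k : tm₂.K) (x : List (tm₂.Γ k)) :
    Function.update (joinStacks S₁ S₂ l) (Sum.inr (Sum.inl k)) x =
      joinStacks S₁ (Function.update S₂ k x) l := by
  funext j
  rcases j with j | j | j
  · rfl
  · by_cases h : j = k
    · subst h; simp [joinStacks]
    · rw [Function.update_of_ne (by simpa using h)]; simp [joinStacks, h]
  · rfl

theorem update_joinStacks_mid (x : List (tm₂.Γ tm₂.k₀)) :
    Function.update (joinStacks S₁ S₂ l) (Sum.inr (Sum.inr ())) x = joinStacks S₁ S₂ x := by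
  funext j
  rcases j with j | j | ⟨⟩
  · rfl
  · rfl
  · exact Function.update_self ..

theorem joinStacks_update_inl (k : tm₁.K) (l : List (tm₁.Γ k)) :
    joinStacks (tm₂ := tm₂) (Function.update (fun _ => []) k l) (fun _ => []) [] =
      Function.update (fun k => ([] : List (CompΓ tm₁ tm₂ k))) (Sum.inl k) l := by
  rw [← update_joinStacks_inl]
  congr 1
  funext j
  rcases j with j | j | j <;> rfl

theorem joinStacks_update_inr (k : tm₂.K) (l : List (tm₂.Γ k)) :
    joinStacks (tm₁ := tm₁) (fun _ => []) (Function.update (fun _ => []) k l) [] =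
      Function.update (fun k => ([] : List (CompΓ tm₁ tm₂ k))) (Sum.inr (Sum.inl k)) l := by
  rw [← update_joinStacks_inr]
  congr 1
  funext j
  rcases j with j | j | j <;> rfl

end joinStacks

/-- The states of the composition. -/
abbrev CompState : Type := tm₁.σ × tm₂.σ × Option (tm₂.Γ tm₂.k₀)

/-- The labels of the composition: those of both machines, and two for the transfer. -/
abbrev CompLabel : Type := tm₁.Λ ⊕ tm₂.Λ ⊕ Bool

variable {tm₁ tm₂} (e : tm₁.Γ tm₁.k₁ ≃ tm₂.Γ tm₂.k₀) [Inhabited (tm₂.Γ tm₂.k₀)]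

/-- The program of the composition. -/
def compProg : CompLabel tm₁ tm₂ → TM2.Stmt (CompΓ tm₁ tm₂) (CompLabel tm₁ tm₂) (CompState tm₁ tm₂)
  | Sum.inl l => TM2.Stmt.embed (Γ' := CompΓ tm₁ tm₂) Sum.inl (fun v => v.1)
      (fun v s => (s, v.2)) Sum.inl (.goto fun _ => Sum.inr (Sum.inr false)) (tm₁.m l)
  | Sum.inr (Sum.inl l) => TM2.Stmt.embed (Γ' := CompΓ tm₁ tm₂) (fun k => Sum.inr (Sum.inl k))
      (fun v => v.2.1) (fun v s => (v.1, s, v.2.2)) (fun l => Sum.inr (Sum.inl l)) .halt (tm₂.m l)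
  | Sum.inr (Sum.inr false) => .pop (Sum.inl tm₁.k₁) (fun v o => (v.1, v.2.1, o.map e))
      (.branch (fun v => v.2.2.isSome)
        -- The default is never pushed: this branch is taken only if a symbol was popped.
        (.push (Sum.inr (Sum.inr ())) (fun v => (v.2.2.getD default : tm₂.Γ tm₂.k₀))
          (.goto fun _ => Sum.inr (Sum.inr false)))
        (.goto fun _ => Sum.inr (Sum.inr true)))
  | Sum.inr (Sum.inr true) => .pop (Sum.inr (Sum.inr ())) (fun v o => (v.1, v.2.1, o))
      (.branch (fun v => v.2.2.isSome)
        (.push (Sum.inr (Sum.inl tm₂.k₀)) (fun v => (v.2.2.getD default : tm₂.Γ tm₂.k₀))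
          (.goto fun _ => Sum.inr (Sum.inr true)))
        (.goto fun _ => Sum.inr (Sum.inl tm₂.main)))

variable (tm₁ tm₂) in
/-- The machine that runs `tm₁`, and then `tm₂` on the output of `tm₁`. -/
def comp : FinTM2 :=
  have := tm₁.kFin
  have := tm₂.kFin
  have := tm₁.ΛFin
  have := tm₂.ΛFin
  have := tm₁.σFin
  have := tm₂.σFin
  have := tm₂.Γk₀Fin
  { K := tm₁.K ⊕ tm₂.K ⊕ Unit
    k₀ := Sum.inl tm₁.k₀
    k₁ := Sum.inr (Sum.inl tm₂.k₁)
    Γ := CompΓ tm₁ tm₂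
    Λ := CompLabel tm₁ tm₂
    main := Sum.inl tm₁.main
    σ := CompState tm₁ tm₂
    initialState := (tm₁.initialState, tm₂.initialState, none)
    Γk₀Fin := tm₁.Γk₀Fin
    m := compProg e }

/-- Popping and pushing reverses the word, which is why it passes through an auxiliary stack and is
reversed again by `stepsTo_transfer_in`. The extra step pops the empty stack and resets the register
to `none`. -/
theorem stepsTo_transfer_out (s₁ : tm₁.σ) (s₂ : tm₂.σ) (o : Option (tm₂.Γ tm₂.k₀))
    (S₁ : ∀ k, List (tm₁.Γ k)) (S₂ : ∀ k, List (tm₂.Γ k)) (l : List (tm₁.Γ tm₁.k₁))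
    (l' : List (tm₂.Γ tm₂.k₀)) :
    StepsTo (compProg e) (l.length + 1)
      ⟨some (Sum.inr (Sum.inr false)), (s₁, s₂, o),
        joinStacks (Function.update S₁ tm₁.k₁ l) S₂ l'⟩
      ⟨some (Sum.inr (Sum.inr true)), (s₁, s₂, none),
        joinStacks (Function.update S₁ tm₁.k₁ []) S₂ ((l.map e).reverse ++ l')⟩ := by
  induction l generalizing o l' with
  | nil =>
    refine StepsTo.cons ?_
    simp only [compProg, TM2.stepAux, update_joinStacks_inl]
    simp [StepsTo, joinStacks]
  | cons a l ih =>
    refine StepsTo.cons ?_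
    simp only [compProg, TM2.stepAux, update_joinStacks_inl, update_joinStacks_mid]
    simpa [joinStacks] using ih (some (e a)) (e a :: l')

theorem stepsTo_transfer_in (s₁ : tm₁.σ) (s₂ : tm₂.σ) (o : Option (tm₂.Γ tm₂.k₀))
    (S₁ : ∀ k, List (tm₁.Γ k)) (S₂ : ∀ k, List (tm₂.Γ k)) (l l' : List (tm₂.Γ tm₂.k₀)) :
    StepsTo (compProg e) (l.length + 1)
      ⟨some (Sum.inr (Sum.inr true)), (s₁, s₂, o),
        joinStacks S₁ (Function.update S₂ tm₂.k₀ l') l⟩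
      ⟨some (Sum.inr (Sum.inl tm₂.main)), (s₁, s₂, none),
        joinStacks S₁ (Function.update S₂ tm₂.k₀ (l.reverse ++ l')) []⟩ := by
  induction l generalizing o l' with
  | nil =>
    refine StepsTo.cons ?_
    simp only [compProg, TM2.stepAux, update_joinStacks_mid]
    simp [StepsTo, joinStacks]
  | cons a l ih =>
    refine StepsTo.cons ?_
    simp only [compProg, TM2.stepAux, update_joinStacks_inr, update_joinStacks_mid]
    simpa [joinStacks] using ih (some a) (a :: l')

theorem stepsTo_comp_left {n : ℕ} {l : tm₁.Λ} {s₁ s₁' : tm₁.σ} {S₁ S₁' : ∀ k, List (tm₁.Γ k)}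
    (h : StepsTo tm₁.m n ⟨some l, s₁, S₁⟩ ⟨none, s₁', S₁'⟩) (v : tm₂.σ × Option (tm₂.Γ tm₂.k₀))
    (S₂ : ∀ k, List (tm₂.Γ k)) (m : List (tm₂.Γ tm₂.k₀)) :
    StepsTo (compProg e) n ⟨some (Sum.inl l), (s₁, v), joinStacks S₁ S₂ m⟩
      ⟨some (Sum.inr (Sum.inr false)), (s₁', v), joinStacks S₁' S₂ m⟩ := by
  obtain ⟨d', hd', S', h1, h2, rfl⟩ := TM2.Stmt.corresponds_of_stepsTo (Γ' := CompΓ tm₁ tm₂)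
    (M' := compProg e) (ι := Sum.inl) Sum.inl_injective
    (get := fun v => v.1) (set := fun v s => (s, v.2)) (fun _ _ => rfl) (fun _ _ _ => rfl)
    (f := Sum.inl) (fun _ => rfl) (v₀ := (s₁, v)) (S₀ := joinStacks S₁ S₂ m)
    h ⟨joinStacks S₁ S₂ m, fun _ => rfl, fun _ _ => rfl, rfl⟩
  convert hd' using 1
  have : S' = joinStacks S₁' S₂ m := by
    funext k
    rcases k with k | k | k
    · exact h1 k
    · exact h2 _ (by simp)
    · exact h2 _ (by simp)
  rw [this]
  rfl

theorem stepsTo_comp_right {n : ℕ} {l : tm₂.Λ} {s₂ s₂' : tm₂.σ} {S₂ S₂' : ∀ k, List (tm₂.Γ k)}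
    (h : StepsTo tm₂.m n ⟨some l, s₂, S₂⟩ ⟨none, s₂', S₂'⟩) (s₁ : tm₁.σ)
    (o : Option (tm₂.Γ tm₂.k₀)) (S₁ : ∀ k, List (tm₁.Γ k)) (m : List (tm₂.Γ tm₂.k₀)) :
    StepsTo (compProg e) n ⟨some (Sum.inr (Sum.inl l)), (s₁, s₂, o), joinStacks S₁ S₂ m⟩
      ⟨none, (s₁, s₂', o), joinStacks S₁ S₂' m⟩ := by
  obtain ⟨d', hd', S', h1, h2, rfl⟩ := TM2.Stmt.corresponds_of_stepsTo (Γ' := CompΓ tm₁ tm₂)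
    (M' := compProg e) (ι := fun k => Sum.inr (Sum.inl k))
    (Sum.inr_injective.comp Sum.inl_injective)
    (get := fun v => v.2.1) (set := fun v s => (v.1, s, v.2.2)) (fun _ _ => rfl)
    (fun _ _ _ => rfl) (f := fun l => Sum.inr (Sum.inl l)) (fun _ => rfl)
    (v₀ := (s₁, s₂, o)) (S₀ := joinStacks S₁ S₂ m)
    h ⟨joinStacks S₁ S₂ m, fun _ => rfl, fun _ _ => rfl, rfl⟩
  convert hd' using 1
  have : S' = joinStacks S₁ S₂' m := by
    funext k
    rcases k with k | k | k
    · exact h2 _ (by simp)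
    · exact h1 k
    · exact h2 _ (by simp)
  rw [this]
  rfl

/-- The summand `2 * (l'.length + 1)` pays for the two transfers. Since the first machine ends
clean, the second starts in its initial configuration, and the final configuration of the
composition is clean as well. -/
theorem comp_outputsInTime {l : List (tm₁.Γ tm₁.k₀)} {l' : List (tm₁.Γ tm₁.k₁)}
    {l'' : List (tm₂.Γ tm₂.k₁)} {m n : ℕ} (h : Nonempty (TM2OutputsInTime tm₁ l (some l') m))
    (h' : Nonempty (TM2OutputsInTime tm₂ (l'.map e) (some l'') n)) :
    Nonempty (TM2OutputsInTime (comp tm₁ tm₂ e) l (some l'') (m + 2 * (l'.length + 1) + n)) := by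
  obtain ⟨m', hm, h⟩ := nonempty_outputsInTime_iff.1 h
  obtain ⟨n', hn, h'⟩ := nonempty_outputsInTime_iff.1 h'
  refine nonempty_outputsInTime_iff.2
    ⟨m' + (l'.length + 1) + ((l'.map e).reverse.length + 1) + n', by simp; omega, ?_⟩
  have h1 := stepsTo_comp_left e h (tm₂.initialState, none) (fun _ => []) []
  have h2 := stepsTo_transfer_out e tm₁.initialState tm₂.initialState none (fun _ => [])
    (fun _ => []) l' []
  have h3 := stepsTo_transfer_in e tm₁.initialState tm₂.initialState none (fun _ => [])
    (fun _ => []) (l'.map e).reverse []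
  have h4 := stepsTo_comp_right e h' tm₁.initialState none (fun _ => []) []
  have hnil : ∀ (tm : FinTM2) (k : tm.K), Function.update (fun k => ([] : List (tm.Γ k))) k [] =
      fun _ => [] := fun tm k => Function.update_eq_self k _
  rw [List.append_nil, hnil] at h2
  rw [hnil, List.append_nil, List.reverse_reverse] at h3
  have := ((h1.trans h2).trans h3).trans h4
  rw [joinStacks_update_inl, joinStacks_update_inr] at this
  exact this

end Turing.FinTM2

/-! ### Clearing, moving and writing stacks -/

namespace StackProg

variable {K : Type} {Γ : K → Type}

/-- Empties a stack. -/
def clear (a : K) : StackProg Γ := loop a Option.isSome (pop a)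

/-- Moves the top symbol of the stack `a` to the stack `b`, provided that it is in the list. -/
def moveTop (a b : K) [DecidableEq (Γ a)] (f : Γ a → Γ b) : List (Γ a) → StackProg Γ
  | [] => skip
  | x :: xs => ite a (fun o => decide (o = some x)) (seq (pop a) (push b (f x))) (moveTop a b f xs)

/-- Moves the stack `a` to the stack `b`, in reverse. -/
def moveAll (a b : K) [DecidableEq (Γ a)] (f : Γ a → Γ b) (xs : List (Γ a)) : StackProg Γ :=
  loop a Option.isSome (moveTop a b f xs)

/-- Pushes the symbols of a word. -/
def pushWord (a : K) : List (Γ a) → StackProg Γ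
  | [] => skip
  | x :: xs => seq (push a x) (pushWord a xs)

variable [DecidableEq K]

namespace RunsIn

variable {p q : StackProg Γ} {S T T' : ∀ k, List (Γ k)} {m n : ℕ}

theorem congr (h : RunsIn p S T m) (hT : T = T') (hmn : m ≤ n) : RunsIn p S T' n :=
  hT ▸ h.mono hmn

theorem clear {a : K} : RunsIn (clear a) S (Function.update S a []) (2 * (S a).length + 1) := by
  generalize hl : S a = l
  induction l generalizing S with
  | nil =>
    refine (loop_false (by rw [hl]; rfl)).congr ?_ (by simp)
    rw [← hl, Function.update_eq_self]
  | cons x l ih =>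
    refine (loop_true (by rw [hl]; rfl) pop (ih (by simp [hl]))).congr (by simp) ?_
    simp only [List.length_cons]
    omega

/-- A program can push only fixed symbols, so the move tests the listed symbols one by one: at most
`xs.length` tests, one pop and one push. -/
theorem moveTop {a b : K} [DecidableEq (Γ a)] {f : Γ a → Γ b} {x : Γ a} {xs : List (Γ a)}
    (hab : a ≠ b) (hx : x ∈ xs) {l : List (Γ a)} (hl : S a = x :: l) :
    RunsIn (moveTop a b f xs) S (Function.update (Function.update S a l) b (f x :: S b))
      (xs.length + 2) := by
  induction xs with
  | nil => cases hx
  | cons y ys ih =>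
    by_cases h : y = x
    · subst h
      refine (ite_true (by simp [hl]) (pop.seq push)).congr ?_ (by simp)
      rw [hl, Function.update_of_ne hab.symm]
      rfl
    · refine (ite_false (by simpa [hl] using Ne.symm h) (ih ?_)).congr rfl (by simp)
      simpa [Ne.symm h] using hx

theorem moveAll {a b : K} [DecidableEq (Γ a)] {f : Γ a → Γ b} {xs : List (Γ a)}
    (hab : a ≠ b) (hx : ∀ x, x ∈ xs) :
    RunsIn (moveAll a b f xs) S
      (Function.update (Function.update S a []) b (((S a).map f).reverse ++ S b))
      ((S a).length * (xs.length + 3) + 1) := by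
  generalize hl : S a = l
  induction l generalizing S with
  | nil =>
    have hS : Function.update S a [] = S := by rw [← hl, Function.update_eq_self]
    exact (loop_false (by rw [hl]; rfl)).congr (by simp [hS]) (by simp)
  | cons x l ih =>
    refine (loop_true (by rw [hl]; rfl) (moveTop hab (hx x) hl)
      (ih (by simp [hab]))).congr ?_ ?_
    · rw [Function.update_comm hab, Function.update_idem, Function.update_comm hab.symm,
        Function.update_idem]
      simp
    · simp only [List.length_cons]
      exact le_of_eq (by ring)

theorem pushWord {a : K} (w : List (Γ a)) :
    RunsIn (pushWord a w) S (Function.update S a (w.reverse ++ S a)) (w.length + 1) := by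
  induction w generalizing S with
  | nil => exact skip.congr (by simp) (by simp)
  | cons x w ih =>
    refine (push.seq ih).congr (by simp) ?_
    simp only [List.length_cons]
    omega

end RunsIn

end StackProg

/-! ### The stacks of the reduction -/

/-- The counters of the program for the reduction. -/
inductive Cnt
  -- Number of variables, current variable, variables still to treat, current clause, scratch space
  -- for copying, mismatches of a literal with the sought one, and occurrences in a clause.
  | vars | i | rem | j | tmp | diff | hits
deriving DecidableEq

instance : Fintype Cnt :=
  ⟨{.vars, .i, .rem, .j, .tmp, .diff, .hits}, fun x => by cases x <;> decide⟩

/-- The stacks of the program for the reduction. -/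
inductive Reg
  | inp | scanned | emitted | out | cnt (c : Cnt)
deriving DecidableEq, Fintype

instance : Fintype FormulaSym :=
  ⟨{.tick, .pos, .neg}, fun x => by cases x <;> decide⟩

/-- The alphabets of the stacks. -/
abbrev Reg.Γ : Reg → Type
  | inp => FormulaSym
  | scanned => FormulaSym
  | emitted => ExecSym
  | out => ExecSym
  | cnt _ => Unit

/-- The contents of the stacks. -/
@[ext]
structure RegState where
  inp : List FormulaSym
  scanned : List FormulaSym
  emitted : List ExecSym
  out : List ExecSym
  cnt : Cnt → ℕ

namespace RegState

/-- The contents of the stacks as a family. -/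
def stk (r : RegState) : ∀ k, List (Reg.Γ k)
  | .inp => r.inp
  | .scanned => r.scanned
  | .emitted => r.emitted
  | .out => r.out
  | .cnt c => List.replicate (r.cnt c) ()

variable (r : RegState)

theorem update_inp (x : List FormulaSym) :
    Function.update r.stk .inp x = stk { r with inp := x } := by
  funext k; cases k <;> simp [stk]

theorem update_scanned (x : List FormulaSym) :
    Function.update r.stk .scanned x = stk { r with scanned := x } := by
  funext k; cases k <;> simp [stk]

theorem update_emitted (x : List ExecSym) :
    Function.update r.stk .emitted x = stk { r with emitted := x } := by
  funext k; cases k <;> simp [stk]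

theorem update_out (x : List ExecSym) :
    Function.update r.stk .out x = stk { r with out := x } := by
  funext k; cases k <;> simp [stk]

theorem update_cnt (c : Cnt) (n : ℕ) :
    Function.update r.stk (.cnt c) (List.replicate n ()) =
      stk { r with cnt := Function.update r.cnt c n } := by
  funext k
  cases k with
  | cnt c' =>
    by_cases h : c' = c
    · subst h; simp [stk]
    · simp [stk, h]
  | _ => simp [stk]

/-- Sets a counter. -/
def set (c : Cnt) (n : ℕ) : RegState := { r with cnt := Function.update r.cnt c n }

/-- Appends a word to the output. -/
def emit (w : List ExecSym) : RegState := { r with emitted := w.reverse ++ r.emitted }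

/-- Moves the word `w` from the input, which leaves `l`, to the stack of the scanned symbols. -/
def scan (w l : List FormulaSym) : RegState :=
  { r with inp := l, scanned := w.reverse ++ r.scanned }

@[simp] theorem scan_inp (w l : List FormulaSym) : (r.scan w l).inp = l := rfl
@[simp] theorem scan_scanned (w l : List FormulaSym) :
    (r.scan w l).scanned = w.reverse ++ r.scanned := rfl
@[simp] theorem scan_emitted (w l : List FormulaSym) : (r.scan w l).emitted = r.emitted := rfl
@[simp] theorem scan_out (w l : List FormulaSym) : (r.scan w l).out = r.out := rfl
@[simp] theorem scan_cnt (w l : List FormulaSym) : (r.scan w l).cnt = r.cnt := rfl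
@[simp] theorem set_inp (c : Cnt) (n : ℕ) : (r.set c n).inp = r.inp := rfl
@[simp] theorem set_scanned (c : Cnt) (n : ℕ) : (r.set c n).scanned = r.scanned := rfl
@[simp] theorem set_emitted (c : Cnt) (n : ℕ) : (r.set c n).emitted = r.emitted := rfl
@[simp] theorem set_out (c : Cnt) (n : ℕ) : (r.set c n).out = r.out := rfl
@[simp] theorem set_cnt (c : Cnt) (n : ℕ) (c' : Cnt) :
    (r.set c n).cnt c' = if c' = c then n else r.cnt c' := by
  simp [set, Function.update_apply]
@[simp] theorem emit_inp (w : List ExecSym) : (r.emit w).inp = r.inp := rfl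
@[simp] theorem emit_scanned (w : List ExecSym) : (r.emit w).scanned = r.scanned := rfl
@[simp] theorem emit_emitted (w : List ExecSym) :
    (r.emit w).emitted = w.reverse ++ r.emitted := rfl
@[simp] theorem emit_out (w : List ExecSym) : (r.emit w).out = r.out := rfl
@[simp] theorem emit_cnt (w : List ExecSym) : (r.emit w).cnt = r.cnt := rfl

theorem emit_emit (w w' : List ExecSym) : (r.emit w).emit w' = r.emit (w ++ w') := by
  simp [emit]

end RegState

/-! ### The program of the reduction -/

namespace Reduction

open StackProg

/-- Increments a counter. -/
def inc (c : Cnt) : StackProg Reg.Γ := push (.cnt c) ()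

/-- Decrements a counter. -/
def dec (c : Cnt) : StackProg Reg.Γ := pop (.cnt c)

/-- A loop while a counter is positive. -/
def whilePos (c : Cnt) (p : StackProg Reg.Γ) : StackProg Reg.Γ := loop (.cnt c) Option.isSome p

/-- A case distinction whether a counter is positive. -/
def ifPos (c : Cnt) (p q : StackProg Reg.Γ) : StackProg Reg.Γ := ite (.cnt c) Option.isSome p q

/-- Adds a counter to another one, and resets it. -/
def moveCnt (c c' : Cnt) : StackProg Reg.Γ := moveAll (.cnt c) (.cnt c') id [()]

/-- Emits a word. -/
def emitWord (w : List ExecSym) : StackProg Reg.Γ := pushWord .emitted w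

/-- Emits the value of a counter in unary. -/
def emitCnt (c : Cnt) : StackProg Reg.Γ :=
  seq (whilePos c (seq (dec c) (seq (inc .tmp) (push .emitted .tick)))) (moveCnt .tmp c)

/-- Emits the sum of the values of some counters in unary. -/
def emitCnts : List Cnt → StackProg Reg.Γ
  | [] => skip
  | c :: cs => seq (emitCnt c) (emitCnts cs)

/-- The symbol of an operation. -/
def opSym : OpKind → ExecSym
  | .read => .read
  | .write => .write

/-- Emits an event at the location that is the sum of some counters. -/
def emitEvent (op : OpKind) (cs : List Cnt) (v : ℕ) : StackProg Reg.Γ :=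
  seq (emitWord [opSym op])
    (seq (emitCnts cs) (emitWord (ExecSym.comma :: List.replicate v ExecSym.tick)))

/-! ### Correctness and cost of the basic operations -/

variable {r : RegState} {c c' : Cnt} {n B : ℕ} {p q : StackProg Reg.Γ}

theorem run_inc : RunsIn (inc c) r.stk (r.set c (r.cnt c + 1)).stk 1 := by
  refine RunsIn.push.congr ?_ le_rfl
  rw [RegState.set, ← RegState.update_cnt]
  rfl

theorem run_dec : RunsIn (dec c) r.stk (r.set c (r.cnt c - 1)).stk 1 := by
  refine RunsIn.pop.congr ?_ le_rfl
  rw [RegState.set, ← RegState.update_cnt]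
  simp [RegState.stk]

theorem isSome_head?_cnt : (r.stk (.cnt c)).head?.isSome = decide (0 < r.cnt c) := by
  cases h : r.cnt c <;> simp [RegState.stk, h, List.replicate_succ]

theorem run_moveCnt (h : c ≠ c') : RunsIn (moveCnt c c') r.stk
    ((r.set c 0).set c' (r.cnt c + r.cnt c')).stk (r.cnt c * 4 + 1) := by
  refine (RunsIn.moveAll (by simpa using h) (by simp)).congr ?_ (by simp [RegState.stk])
  rw [RegState.set, RegState.set, ← RegState.update_cnt, ← RegState.update_cnt]
  simp [RegState.stk]

theorem run_clear_cnt : RunsIn (clear (.cnt c)) r.stk (r.set c 0).stk (2 * r.cnt c + 1) := by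
  refine RunsIn.clear.congr ?_ (by simp [RegState.stk])
  rw [RegState.set, ← RegState.update_cnt]
  rfl

theorem run_emitWord (w : List ExecSym) :
    RunsIn (emitWord w) r.stk (r.emit w).stk (w.length + 1) :=
  (RunsIn.pushWord (Γ := Reg.Γ) (a := Reg.emitted) w).congr (RegState.update_emitted r _) le_rfl

theorem run_emitTick : RunsIn (push .emitted .tick) r.stk (r.emit [.tick]).stk 1 :=
   RunsIn.push.congr (RegState.update_emitted r _) le_rfl

theorem run_whilePos {r' : RegState} (F : ℕ → RegState) (B : ℕ) (h0 : F 0 = r) (hF : F n = r')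
    (hP : ∀ i < n, 0 < (F i).cnt c) (hn : (F n).cnt c = 0)
    (h : ∀ i < n, RunsIn p (F i).stk (F (i + 1)).stk B) :
    RunsIn (whilePos c p) r.stk r'.stk (n * (B + 1) + 1) := by
  subst h0 hF
  exact RunsIn.loop (fun i => (F i).stk) B
    (fun i hi => isSome_head?_cnt.trans (by simpa using hP i hi))
    (isSome_head?_cnt.trans (by simpa using hn)) h

theorem run_ifPos_pos {S : ∀ k, List (Reg.Γ k)} (hc : 0 < r.cnt c) (h : RunsIn p r.stk S n) :
    RunsIn (ifPos c p q) r.stk S (n + 1) :=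
  RunsIn.ite_true (isSome_head?_cnt.trans (by simpa using hc)) h

theorem run_ifPos_zero {S : ∀ k, List (Reg.Γ k)} (hc : r.cnt c = 0) (h : RunsIn q r.stk S n) :
    RunsIn (ifPos c p q) r.stk S (n + 1) :=
  RunsIn.ite_false (isSome_head?_cnt.trans (by simpa using hc)) h

theorem replicate_append_cons {α : Type*} (a : α) (n : ℕ) (l : List α) :
    List.replicate n a ++ a :: l = a :: (List.replicate n a ++ l) := by
  induction n with
  | zero => rfl
  | succ n ih => simp [List.replicate_succ, ih]

/-- Reading a unary counter destroys it, so it is copied to `.tmp` along the way and moved back.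
After `t` rounds the counter has lost `t`, `.tmp` holds `t`, and `t` ticks are emitted. -/
theorem run_emitCnt (hc : c ≠ .tmp) (ht : r.cnt .tmp = 0) :
    RunsIn (emitCnt c) r.stk (r.emit (List.replicate (r.cnt c) .tick)).stk (8 * r.cnt c + 2) := by
  have h1 := run_whilePos (r := r) (n := r.cnt c) (c := c)
    (p := seq (dec c) (seq (inc .tmp) (push .emitted .tick)))
    (fun t => ((r.set c (r.cnt c - t)).set .tmp t).emit (List.replicate t .tick)) 3
    (by
      ext1
      iterate 4 simp
      funext d
      simp
      grind) rfl (fun t ht => by simp [hc]; omega) (by simp [hc]) (fun t h => by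
      refine (run_dec.seq (run_inc.seq run_emitTick)).congr ?_ le_rfl
      congr 1
      ext1
      · simp
      · simp
      · simp [List.replicate_succ, replicate_append_cons]
      · simp
      · funext d
        simp [hc]
        grind)
  refine (h1.seq (run_moveCnt (c' := c) hc.symm)).congr ?_ ?_
  · congr 1
    ext1
    iterate 4 simp
    funext d
    simp
    grind
  · simp
    omega

theorem run_emitCnts (cs : List Cnt) (hc : .tmp ∉ cs) (ht : r.cnt .tmp = 0)
    (hB : ∀ c ∈ cs, r.cnt c ≤ B) : RunsIn (emitCnts cs) r.stk
      (r.emit (List.replicate (cs.map r.cnt).sum .tick)).stk (cs.length * (8 * B + 2) + 1) := by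
  induction cs generalizing r with
  | nil => exact RunsIn.skip.congr (by simp [RegState.emit]) (by simp)
  | cons c cs ih =>
    simp only [List.mem_cons, not_or] at hc hB
    refine ((run_emitCnt (Ne.symm hc.1) ht).seq (ih hc.2 ht fun c h => hB c (.inr h))).congr ?_ ?_
    · rw [RegState.emit_emit]
      simp
    · have := hB c (.inl rfl)
      simp only [List.length_cons, add_mul]
      omega

theorem run_emitEvent {op : OpKind} {cs : List Cnt} {v x : ℕ} (hc : .tmp ∉ cs)
    (ht : r.cnt .tmp = 0) (hB : ∀ c ∈ cs, r.cnt c ≤ B) (hx : (cs.map r.cnt).sum = x)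
    (hl : cs.length ≤ 3) (hv : v ≤ 2) : RunsIn (emitEvent op cs v) r.stk
      (r.emit (MemEvent.encode ⟨op, x, v⟩)).stk (24 * B + 13) := by
  refine ((run_emitWord _).seq ((run_emitCnts (r := r.emit _) cs hc ht hB).seq
    (run_emitWord _))).congr ?_ ?_
  · rw [RegState.emit_emit, RegState.emit_emit, RegState.emit_cnt, hx]
    cases op <;> simp [MemEvent.encode, opSym]
  · simp only [List.length_cons, List.length_nil, List.length_replicate]
    have := Nat.mul_le_mul_right (8 * B + 2) hl
    omega

/-! ### Scanning literals and clauses -/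

/-- The sign of a literal. -/
def signSym (b : Bool) : FormulaSym := if b then .pos else .neg

/-- The encoding of a literal. -/
def encodeLit {k : ℕ} (l : Lit k) : List FormulaSym :=
  signSym l.2 :: List.replicate (l.1 : ℕ) FormulaSym.tick

/-- The encoding of a clause. -/
def encodeClause {k : ℕ} (C : Fin 3 → Lit k) : List FormulaSym := (List.ofFn C).flatMap encodeLit

theorem encode_eq (φ : Formula3) : φ.encode =
    List.replicate φ.numVars FormulaSym.tick ++ φ.clauses.flatMap encodeClause := rfl

/-- Replaces the top of the input by a symbol on the stack of the scanned symbols. -/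
def scanSym (x : FormulaSym) : StackProg Reg.Γ := seq (pop .inp) (push .scanned x)

/-- A loop over the ticks at the top of the input. -/
def whileTick (p : StackProg Reg.Γ) : StackProg Reg.Γ :=
  loop .inp (fun o => decide (o = some FormulaSym.tick)) p

/-- Scans a literal, and counts a hit if it is the literal `(i, b)`. -/
def matchLit (b : Bool) : StackProg Reg.Γ :=
  seq (ite .inp (fun o => decide (o = some (signSym b))) (scanSym (signSym b))
    (seq (scanSym (signSym !b)) (inc .diff)))
  (seq (whileTick (seq (scanSym .tick) (ifPos .i (seq (dec .i) (inc .tmp)) (inc .diff))))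
  (seq (ifPos .i (inc .diff) skip)
  (seq (moveCnt .tmp .i)
  (ifPos .diff (clear (.cnt .diff)) (inc .hits)))))

theorem run_pop_inp {l : List FormulaSym} {y : FormulaSym} (h : r.inp = y :: l) :
    RunsIn (pop .inp) r.stk (RegState.stk { r with inp := l }) 1 :=
  RunsIn.pop.congr ((RegState.update_inp r _).trans
    (congrArg (fun l => RegState.stk { r with inp := l }) (congrArg List.tail h))) le_rfl

theorem run_scanSym {l : List FormulaSym} {x y : FormulaSym} (h : r.inp = y :: l) :
    RunsIn (scanSym x) r.stk
      (r.scan [x] l).stk 2 :=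
  (run_pop_inp h).seq (RunsIn.push.congr (RegState.update_scanned _ _) le_rfl)

theorem run_whileTick {r' : RegState} (F : ℕ → RegState) (B : ℕ) (h0 : F 0 = r) (hF : F n = r')
    (hP : ∀ i < n, (F i).inp.head? = some FormulaSym.tick)
    (hn : (F n).inp.head? ≠ some FormulaSym.tick)
    (h : ∀ i < n, RunsIn p (F i).stk (F (i + 1)).stk B) :
    RunsIn (whileTick p) r.stk r'.stk (n * (B + 1) + 1) := by
  subst h0 hF
  exact RunsIn.loop (fun i => (F i).stk) B (fun i hi => decide_eq_true (hP i hi))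
    (decide_eq_false hn) h

theorem run_matchSign {b s : Bool} {l : List FormulaSym} (h : r.inp = signSym s :: l)
    (hd : r.cnt .diff = 0) :
    RunsIn (ite .inp (fun o => decide (o = some (signSym b))) (scanSym (signSym b))
      (seq (scanSym (signSym !b)) (inc .diff))) r.stk
      ((r.scan [signSym s] l).set .diff (if s = b then 0 else 1)).stk 4 := by
  by_cases hs : s = b
  · subst hs
    refine (RunsIn.ite_true (decide_eq_true ?_) (run_scanSym h)).congr ?_ (by omega)
    · exact congrArg List.head? h
    · congr 1
      ext1
      iterate 4 simp
      funext d
      simp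
      grind
  · refine (RunsIn.ite_false (decide_eq_false ?_) ((run_scanSym h).seq run_inc)).congr ?_ le_rfl
    · rw [show r.stk .inp = signSym s :: l from h]
      cases s <;> cases b <;> simp_all [signSym]
    · obtain rfl : s = !b := by revert hs; cases s <;> cases b <;> simp
      congr 1
      ext1
      iterate 4 simp
      funext d
      simp [hd]

theorem head?_ticks {n : ℕ} {rest : List FormulaSym} (h : 0 < n) :
    (List.replicate n FormulaSym.tick ++ rest).head? = some FormulaSym.tick := by
  obtain ⟨n, rfl⟩ := Nat.exists_eq_succ_of_ne_zero h.ne'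
  rfl

theorem ticks_eq_cons {n : ℕ} {rest : List FormulaSym} (h : 0 < n) :
    List.replicate n FormulaSym.tick ++ rest =
      FormulaSym.tick :: (List.replicate (n - 1) FormulaSym.tick ++ rest) := by
  obtain ⟨n, rfl⟩ := Nat.exists_eq_succ_of_ne_zero h.ne'
  rfl

/-- Each tick moves a unit from `.i` to `.tmp` while there is one; the ticks in excess of the index
are counted as mismatches in `.diff`. -/
theorem run_matchTicks {rest : List FormulaSym}
    (h : r.inp = List.replicate n FormulaSym.tick ++ rest)
    (hrest : rest.head? ≠ some FormulaSym.tick) (ht : r.cnt .tmp = 0) :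
    RunsIn (whileTick (seq (scanSym .tick) (ifPos .i (seq (dec .i) (inc .tmp)) (inc .diff))))
      r.stk ((((r.scan (List.replicate n FormulaSym.tick) rest).set .i (r.cnt .i - n)).set
        .tmp (min n (r.cnt .i))).set .diff (r.cnt .diff + (n - r.cnt .i))).stk (n * 6 + 1) := by
  refine run_whileTick (fun t => (((r.scan (List.replicate t FormulaSym.tick)
      (List.replicate (n - t) FormulaSym.tick ++ rest)).set .i (r.cnt .i - t)).set
        .tmp (min t (r.cnt .i))).set .diff (r.cnt .diff + (t - r.cnt .i))) 5 ?_ (by simp)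
    (fun t ht => head?_ticks (by omega)) (by simpa using hrest) (fun t h => ?_)
  · ext1
    · simp [h]
    iterate 3 simp
    funext d
    simp
    grind
  · have h1 := run_scanSym (x := .tick) (r := (((r.scan (List.replicate t FormulaSym.tick)
      (List.replicate (n - t) FormulaSym.tick ++ rest)).set .i (r.cnt .i - t)).set
        .tmp (min t (r.cnt .i))).set .diff (r.cnt .diff + (t - r.cnt .i)))
      (ticks_eq_cons (n := n - t) (rest := rest) (by omega))
    by_cases hi : t < r.cnt .i
    · refine (h1.seq (run_ifPos_pos (by simp; omega) (run_dec.seq run_inc))).congr ?_ le_rfl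
      congr 1
      ext1
      · simp [Nat.sub_sub]
      · simp [List.replicate_succ, replicate_append_cons]
      · simp
      · simp
      · funext d
        simp
        grind
    · refine (h1.seq (run_ifPos_zero (by simp; omega) run_inc)).congr ?_ (by norm_num)
      congr 1
      ext1
      · simp [Nat.sub_sub]
      · simp [List.replicate_succ, replicate_append_cons]
      · simp
      · simp
      · funext d
        simp
        grind

/-- Here `e` is the mismatch of the sign. A remainder in `.i` means that the scanned index was too
small and adds a mismatch, so `.diff` is zero exactly for the sought literal. As `min n i + (i - n)
= i`, moving `.tmp` back restores `.i`. -/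
theorem run_matchEnd {i e : ℕ} (hi : r.cnt .i = i - n) (ht : r.cnt .tmp = min n i)
    (hd : r.cnt .diff = e + (n - i)) :
    RunsIn (seq (ifPos .i (inc .diff) skip) (seq (moveCnt .tmp .i)
      (ifPos .diff (clear (.cnt .diff)) (inc .hits)))) r.stk
      ((((r.set .tmp 0).set .i i).set .diff 0).set .hits
        (r.cnt .hits + if n = i ∧ e = 0 then 1 else 0)).stk (6 * n + 2 * e + 7) := by
  by_cases h : n < i
  · refine ((run_ifPos_pos (by omega) run_inc).seq ((run_moveCnt (by simp)).seq
      (run_ifPos_pos (by simp) run_clear_cnt))).congr (congrArg _ (RegState.ext ?_ ?_ ?_ ?_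
        (funext fun d => ?_))) ?_
    iterate 4 simp
    · simp
      grind
    · simp
      omega
  · refine ((run_ifPos_zero (by omega) RunsIn.skip).seq ((run_moveCnt (by simp)).seq
      (?_ : RunsIn _ _ _ (2 * (e + (n - i)) + 2)))).mono ?_
    · by_cases h' : n = i ∧ e = 0
      · refine (run_ifPos_zero (by simp; omega) run_inc).congr (congrArg _
          (RegState.ext ?_ ?_ ?_ ?_ (funext fun d => ?_))) (by omega)
        iterate 4 simp
        simp
        grind
      · refine (run_ifPos_pos (by simp; omega) run_clear_cnt).congr (congrArg _
          (RegState.ext ?_ ?_ ?_ ?_ (funext fun d => ?_))) (by simp; omega)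
        iterate 4 simp
        simp
        grind
    · omega

theorem run_matchLit {b s : Bool} {rest : List FormulaSym}
    (h : r.inp = signSym s :: (List.replicate n FormulaSym.tick ++ rest))
    (hrest : rest.head? ≠ some FormulaSym.tick) (ht : r.cnt .tmp = 0) (hd : r.cnt .diff = 0) :
    RunsIn (matchLit b) r.stk
      ((r.scan (signSym s :: List.replicate n FormulaSym.tick) rest).set .hits
        (r.cnt .hits + if n = r.cnt .i ∧ s = b then 1 else 0)).stk (12 * n + 14) := by
  refine ((run_matchSign (b := b) h hd).seq ((run_matchTicks (n := n) (rest := rest)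
    rfl hrest (by simpa using ht)).seq (run_matchEnd (n := n) (i := r.cnt .i)
    (e := if s = b then 0 else 1) (by simp) (by simp) (by simp)))).congr (congrArg _
      (RegState.ext ?_ ?_ ?_ ?_ (funext fun d => ?_))) ?_
  iterate 4 simp
  · simp
    grind
  · split_ifs <;> omega

theorem encodeClause_eq {k : ℕ} (C : Fin 3 → Lit k) :
    encodeClause C = encodeLit (C 0) ++ (encodeLit (C 1) ++ encodeLit (C 2)) := by
  simp [encodeClause, List.ofFn_succ]

/-- A literal begins with its sign, so the loop over the ticks of the preceding literal stops in
time. -/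
theorem head?_encodeLit {k : ℕ} (l : Lit k) (w : List FormulaSym) :
    (encodeLit l ++ w).head? ≠ some FormulaSym.tick := by
  rcases l with ⟨i, _ | _⟩ <;> simp [encodeLit, signSym]

theorem head?_encodeClauses {k : ℕ} (cs : List (Fin 3 → Lit k)) :
    (cs.flatMap encodeClause).head? ≠ some FormulaSym.tick := by
  rcases cs with _ | ⟨C, cs⟩
  · simp
  · rw [List.flatMap_cons, encodeClause_eq, List.append_assoc]
    exact head?_encodeLit _ _

/-- Scans a clause, and counts the occurrences of the literal `(i, b)`. -/
def matchClause (b : Bool) : StackProg Reg.Γ := seq (matchLit b) (seq (matchLit b) (matchLit b))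

theorem run_matchLit' {k : ℕ} {i : Fin k} {b : Bool} {l : Lit k} {rest : List FormulaSym}
    (h : r.inp = encodeLit l ++ rest) (hrest : rest.head? ≠ some FormulaSym.tick)
    (ht : r.cnt .tmp = 0) (hd : r.cnt .diff = 0) (hi : r.cnt .i = i) (hk : k ≤ B) :
    RunsIn (matchLit b) r.stk
      ((r.scan (encodeLit l) rest).set .hits (r.cnt .hits + if l = (i, b) then 1 else 0)).stk
      (12 * B + 14) := by
  refine (run_matchLit (b := b) (s := l.2) (n := l.1) h hrest ht hd).congr ?_ ?_
  · rw [hi]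
    simp only [Prod.ext_iff, Fin.ext_iff]
    rfl
  · have := l.1.2
    omega

theorem run_matchClause {k : ℕ} {i : Fin k} {b : Bool} {C : Fin 3 → Lit k}
    {rest : List FormulaSym} (h : r.inp = encodeClause C ++ rest)
    (hrest : rest.head? ≠ some FormulaSym.tick)
    (ht : r.cnt .tmp = 0) (hd : r.cnt .diff = 0) (hi : r.cnt .i = i) (hk : k ≤ B) :
    RunsIn (matchClause b) r.stk
      ((r.scan (encodeClause C) rest).set .hits (r.cnt .hits + ((if C 0 = (i, b) then 1 else 0) +
        (if C 1 = (i, b) then 1 else 0) + if C 2 = (i, b) then 1 else 0))).stk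
      (36 * B + 42) := by
  rw [encodeClause_eq, List.append_assoc, List.append_assoc] at h
  refine ((run_matchLit' (i := i) h (head?_encodeLit _ _) ht hd hi hk).seq
    ((run_matchLit' (i := i) rfl (head?_encodeLit _ _) (by simpa using ht) (by simpa using hd)
      (by simpa using hi) hk).seq
    (run_matchLit' (i := i) rfl hrest (by simpa using ht) (by simpa using hd)
      (by simpa using hi) hk))).congr (congrArg _
      (RegState.ext ?_ ?_ ?_ ?_ (funext fun d => ?_))) (by omega)
  · simp
  · simp [encodeClause_eq]
  · simp
  · simp
  · simp
    grind

/-- Scans a clause, and emits a write if it contains the literal `(i, b)`. -/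
def litClause (b : Bool) : StackProg Reg.Γ :=
  seq (matchClause b) (seq (ifPos .hits (seq (clear (.cnt .hits))
    (emitEvent .write [.vars, .vars, .j] 1)) skip) (inc .j))

/-- The hits are cleared before the write is emitted, so a literal repeated in a clause yields only
one write. The location `2k + j` is emitted as the sum `.vars + .vars + .j`. -/
theorem run_litClause {k : ℕ} {i : Fin k} {b : Bool} {C : Fin 3 → Lit k}
    {rest : List FormulaSym} (h : r.inp = encodeClause C ++ rest)
    (hrest : rest.head? ≠ some FormulaSym.tick)
    (ht : r.cnt .tmp = 0) (hd : r.cnt .diff = 0) (hh : r.cnt .hits = 0) (hi : r.cnt .i = i)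
    (hv : r.cnt .vars = k) (hk : k ≤ B) (hj : r.cnt .j ≤ B) :
    RunsIn (litClause b) r.stk (((r.scan (encodeClause C) rest).emit
      (if ∃ p, C p = (i, b) then MemEvent.encode ⟨.write, 2 * k + r.cnt .j, 1⟩ else [])).set
        .j (r.cnt .j + 1)).stk (60 * B + 64) := by
  have h1 := run_matchClause (b := b) h hrest ht hd hi hk
  by_cases hC : ∃ p, C p = (i, b)
  · have hpos : 0 < (if C 0 = (i, b) then 1 else 0) +
        (if C 1 = (i, b) then 1 else 0) + if C 2 = (i, b) then 1 else 0 := by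
      obtain ⟨p, hp⟩ := hC
      fin_cases p <;> simp at hp <;> simp [hp]
    refine (h1.seq ((run_ifPos_pos (by simpa using Or.inr hpos) (run_clear_cnt.seq (run_emitEvent
      (B := B) (x := 2 * k + r.cnt .j) (by simp) (by simpa using ht) (by simp [hv, hk, hj])
      (by simp [hv]; omega) (by simp) (by simp)))).seq run_inc)).congr (congrArg _
      (RegState.ext ?_ ?_ ?_ ?_ (funext fun d => ?_))) ?_
    · simp
    · simp
    · simp [hC]
    · simp
    · simp
      grind
    · simp only [RegState.set_cnt, if_true, hh]
      split_ifs <;> omega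
  · have hzero : (if C 0 = (i, b) then 1 else 0) +
        (if C 1 = (i, b) then 1 else 0) + (if C 2 = (i, b) then 1 else 0) = 0 := by
      push Not at hC
      simp [hC]
    refine (h1.seq ((run_ifPos_zero (by simp [hzero, hh]) RunsIn.skip).seq run_inc)).congr
      (congrArg _ (RegState.ext ?_ ?_ ?_ ?_ (funext fun d => ?_))) (by omega)
    · simp
    · simp
    · simp [hC]
    · simp
    · simp
      grind

/-- The concatenation of the words `f j` for the members of a list that have the property `P`, where
`j` counts the members. -/
def indexedFlatMap {α β : Type*} (P : α → Prop) [DecidablePred P] (f : ℕ → List β) :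
    List α → ℕ → List β
  | [], _ => []
  | a :: l, j => (if P a then f j else []) ++ indexedFlatMap P f l (j + 1)

/-- This relates the recursion of a loop with a running clause counter to the threads, which are
defined by filtering `List.finRange`. -/
theorem indexedFlatMap_eq {α β : Type*} (P : α → Prop) [DecidablePred P] (f : ℕ → List β)
    (l : List α) (j : ℕ) : indexedFlatMap P f l j =
      ((List.finRange l.length).filter fun t => P (l.get t)).flatMap
        fun t : Fin l.length => f (j + t) := by
  induction l generalizing j with
  | nil => simp [indexedFlatMap]
  | cons a l ih =>
    rw [indexedFlatMap, ih, show List.finRange (a :: l).length = 0 :: (List.finRange l.length).map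
      Fin.succ from List.finRange_succ, List.filter_cons]
    have : (List.filter (fun t => decide (P ((a :: l).get t)))
        (List.map Fin.succ (List.finRange l.length))).flatMap
          (fun t : Fin (l.length + 1) => f (j + t)) =
        ((List.finRange l.length).filter fun t => P (l.get t)).flatMap
          fun t : Fin l.length => f (j + 1 + t) := by
      rw [List.filter_map, List.flatMap_map]
      simp [Function.comp_def, Nat.add_assoc, Nat.add_comm 1]
    split_ifs <;> simp_all

theorem run_loop_inp_pos {S : ∀ k, List (Reg.Γ k)} {m : ℕ} {T : ∀ k, List (Reg.Γ k)}
    (hr : r.inp ≠ []) (h : RunsIn p r.stk S m)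
    (h' : RunsIn (loop .inp Option.isSome p) S T n) :
    RunsIn (loop .inp Option.isSome p) r.stk T (m + n + 1) := by
  refine RunsIn.loop_true ?_ h h'
  rw [show r.stk .inp = r.inp from rfl]
  cases hi : r.inp with
  | nil => exact absurd hi hr
  | cons => rfl

theorem run_loop_inp_nil (hr : r.inp = []) : RunsIn (loop .inp Option.isSome p) r.stk r.stk 1 :=
  RunsIn.loop_false (by rw [show r.stk .inp = r.inp from rfl, hr]; rfl)

theorem encodeClause_ne_nil {k : ℕ} (C : Fin 3 → Lit k) (w : List FormulaSym) :
    encodeClause C ++ w ≠ [] := by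
  simp [encodeClause_eq, encodeLit]

theorem run_litClauses {k : ℕ} {i : Fin k} {b : Bool} (cs : List (Fin 3 → Lit k))
    (h : r.inp = cs.flatMap encodeClause)
    (ht : r.cnt .tmp = 0) (hd : r.cnt .diff = 0) (hh : r.cnt .hits = 0) (hi : r.cnt .i = i)
    (hv : r.cnt .vars = k) (hk : k ≤ B) (hj : r.cnt .j + cs.length ≤ B) :
    RunsIn (loop .inp Option.isSome (litClause b)) r.stk
      (((r.scan (cs.flatMap encodeClause) []).emit
        (indexedFlatMap (fun C => ∃ p, C p = (i, b))
          (fun j => MemEvent.encode ⟨.write, 2 * k + j, 1⟩) cs (r.cnt .j))).set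
        .j (r.cnt .j + cs.length)).stk (cs.length * (60 * B + 65) + 1) := by
  induction cs generalizing r with
  | nil =>
    refine (run_loop_inp_nil h).congr (congrArg _
      (RegState.ext ?_ ?_ ?_ ?_ (funext fun d => ?_))) (by omega)
    · simpa using h
    · simp
    · simp [indexedFlatMap]
    · simp
    · simp
      grind
  | cons C cs ih =>
    rw [List.length_cons] at hj
    rw [List.flatMap_cons] at h
    refine (run_loop_inp_pos (by rw [h]; exact encodeClause_ne_nil _ _)
      (run_litClause (b := b) (i := i) h (head?_encodeClauses cs) ht hd hh hi hv hk (by omega))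
      (ih rfl (by simpa using ht) (by simpa using hd) (by simpa using hh) (by simpa using hi)
        (by simpa using hv) (by simp; omega))).congr (congrArg _
      (RegState.ext ?_ ?_ ?_ ?_ (funext fun d => ?_))) ?_
    · simp
    · simp
    · simp [indexedFlatMap]
    · simp
    · simp
      grind
    · rw [List.length_cons, add_mul]
      omega

/-! ### The threads of the variables -/

/-- The encoding of a thread. -/
def encodeThread (T : List MemEvent) : List ExecSym := T.flatMap MemEvent.encode ++ [ExecSym.semi]

/-- Emits the thread of the literal `(i, b)`. -/
def litProg (b : Bool) : StackProg Reg.Γ :=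
  seq (emitEvent .read [.vars, .i] b.toNat) (seq (loop .inp Option.isSome (litClause b))
    (seq (clear (.cnt .j)) (seq (moveAll .scanned .inp id [.tick, .pos, .neg])
      (emitWord [.semi]))))

/-- The scanned symbols lie in reverse, so moving them back restores the input for the next literal
thread. -/
theorem run_restore : RunsIn (moveAll .scanned .inp id [.tick, .pos, .neg]) r.stk
    (RegState.stk { r with inp := r.scanned.reverse ++ r.inp, scanned := [] })
    (r.scanned.length * 6 + 1) := by
  refine (RunsIn.moveAll (by simp) (fun x => by cases x <;> simp)).congr ?_ le_rfl
  rw [RegState.update_scanned, RegState.update_inp]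
  simp [RegState.stk]

theorem encodeThread_litThread (φ : Formula3) (i : Fin φ.numVars) (b : Bool) :
    encodeThread (φ.litThread (i, b)) =
      MemEvent.encode ⟨.read, φ.numVars + i, b.toNat⟩ ++
        (indexedFlatMap (fun C => ∃ p, C p = (i, b))
          (fun j => MemEvent.encode ⟨.write, 2 * φ.numVars + j, 1⟩) φ.clauses 0 ++ [.semi]) := by
  rw [indexedFlatMap_eq, encodeThread, Formula3.litThread, List.flatMap_cons, List.append_assoc,
    List.flatMap_map]
  simp [Formula3.vLoc, Formula3.cLoc]

/-- The parameter `B` bounds the number of variables, the number of clauses and the length of the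
input at once. The quadratic term comes from the pass over the clauses. -/
theorem run_litProg (φ : Formula3) {i : Fin φ.numVars} {b : Bool}
    (h : r.inp = φ.clauses.flatMap encodeClause) (hs : r.scanned = [])
    (ht : r.cnt .tmp = 0) (hd : r.cnt .diff = 0) (hh : r.cnt .hits = 0) (hj : r.cnt .j = 0)
    (hi : r.cnt .i = i) (hv : r.cnt .vars = φ.numVars) (hk : φ.numVars ≤ B)
    (hB : r.inp.length ≤ B) (hm : φ.clauses.length ≤ B) :
    RunsIn (litProg b) r.stk (r.emit (encodeThread (φ.litThread (i, b)))).stk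
      (60 * B * B + 97 * B + 18) := by
  refine ((run_emitEvent (B := B) (x := φ.numVars + i) (by simp) ht
    (by have := i.2; simp [hv, hk, hi]; omega) (by simp [hv, hi]) (by simp) ?_).seq
    ((run_litClauses (r := r.emit _) (i := i) (B := B) φ.clauses h
      (by simpa using ht) (by simpa using hd) (by simpa using hh) (by simpa using hi) (by simpa using hv) hk
      (by simpa [hj] using hm)).seq
    (run_clear_cnt.seq (run_restore.seq (run_emitWord _))))).congr (congrArg _
      (RegState.ext ?_ ?_ ?_ ?_ (funext fun d => ?_))) ?_
  · cases b <;> simp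
  · simp [h, hs]
  · simp [hs]
  · rw [encodeThread_litThread]
    simp [hj]
  · simp
  · simp
    grind
  · have : φ.clauses.length * (60 * B + 65) ≤ B * (60 * B + 65) := Nat.mul_le_mul_right _ hm
    rw [h] at hB
    simp [hs, hj] at hB ⊢
    nlinarith

/-- Emits the thread `T_i^b`. -/
def valProg (b : Bool) : StackProg Reg.Γ :=
  seq (emitEvent .write [.i] 1) (seq (emitEvent .write [.i] 2)
    (seq (emitEvent .write [.vars, .i] b.toNat) (emitWord [.semi])))

theorem run_valProg (φ : Formula3) {i : Fin φ.numVars} {b : Bool} (ht : r.cnt .tmp = 0)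
    (hi : r.cnt .i = i) (hv : r.cnt .vars = φ.numVars) (hk : φ.numVars ≤ B) :
    RunsIn (valProg b) r.stk (r.emit (encodeThread (φ.valueThread i b))).stk (72 * B + 41) := by
  have hi' := i.2
  refine ((run_emitEvent (B := B) (x := i) (by simp) ht (by simp [hi]; omega) (by simp [hi])
    (by simp) (by simp)).seq ((run_emitEvent (r := r.emit _) (B := B) (x := i) (by simp)
      (by simpa using ht) (by simp [hi]; omega) (by simp [hi]) (by simp) (by simp)).seq
    ((run_emitEvent (r := (r.emit _).emit _) (B := B) (x := φ.numVars + i) (by simp)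
      (by simpa using ht) (by simp [hi, hv]; omega) (by simp [hi, hv]) (by simp)
      (by cases b <;> simp)).seq (run_emitWord _)))).congr ?_ (by simp; omega)
  rw [RegState.emit_emit, RegState.emit_emit, RegState.emit_emit]
  simp [encodeThread, Formula3.valueThread, Formula3.sLoc, Formula3.vLoc]

/-- Emits the threads of a variable. -/
def varProg : StackProg Reg.Γ :=
  seq (dec .rem) (seq (valProg true) (seq (valProg false)
    (seq (litProg true) (seq (litProg false) (inc .i)))))

/-- The encoding of the threads of a variable. -/
def encodeVar (φ : Formula3) (i : Fin φ.numVars) : List ExecSym :=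
  PartialExec.encode [φ.valueThread i true, φ.valueThread i false, φ.litThread (i, true),
    φ.litThread (i, false)]

theorem run_varProg (φ : Formula3) {i : Fin φ.numVars}
    (h : r.inp = φ.clauses.flatMap encodeClause) (hs : r.scanned = [])
    (ht : r.cnt .tmp = 0) (hd : r.cnt .diff = 0) (hh : r.cnt .hits = 0) (hj : r.cnt .j = 0)
    (hi : r.cnt .i = i) (hv : r.cnt .vars = φ.numVars) (hk : φ.numVars ≤ B)
    (hB : r.inp.length ≤ B) (hm : φ.clauses.length ≤ B) :
    RunsIn varProg r.stk (((r.emit (encodeVar φ i)).set .rem (r.cnt .rem - 1)).set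
      .i (i + 1)).stk (120 * B * B + 338 * B + 120) := by
  refine (run_dec.seq ((run_valProg φ (i := i) (by simpa using ht) (by simpa using hi)
    (by simpa using hv) hk).seq ((run_valProg φ (i := i) (by simpa using ht) (by simpa using hi)
    (by simpa using hv) hk).seq ((run_litProg φ (i := i) (by simpa using h) (by simpa using hs)
      (by simpa using ht) (by simpa using hd) (by simpa using hh) (by simpa using hj)
      (by simpa using hi) (by simpa using hv) hk (by simpa using hB) hm).seq
    ((run_litProg φ (i := i) (by simpa using h) (by simpa using hs)
      (by simpa using ht) (by simpa using hd) (by simpa using hh) (by simpa using hj)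
      (by simpa using hi) (by simpa using hv) hk (by simpa using hB) hm).seq
      run_inc))))).congr (congrArg _ (RegState.ext ?_ ?_ ?_ ?_ (funext fun d => ?_))) ?_
  · simp
  · simp
  · simp [encodeVar, PartialExec.encode, encodeThread]
  · simp
  · simp
    grind
  · nlinarith

/-- Emits the threads of all variables. -/
def varsProg : StackProg Reg.Γ := whilePos .rem varProg

/-- After `t` rounds the threads of the first `t` variables are emitted, `.rem` is `k - t` and `.i`
is `t`; the separate counter `.rem` keeps `.vars` available for the locations. -/
theorem run_varsProg (φ : Formula3)
    (h : r.inp = φ.clauses.flatMap encodeClause) (hs : r.scanned = [])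
    (ht : r.cnt .tmp = 0) (hd : r.cnt .diff = 0) (hh : r.cnt .hits = 0) (hj : r.cnt .j = 0)
    (hi : r.cnt .i = 0) (hv : r.cnt .vars = φ.numVars) (hr : r.cnt .rem = φ.numVars)
    (hk : φ.numVars ≤ B) (hB : r.inp.length ≤ B) (hm : φ.clauses.length ≤ B) :
    RunsIn varsProg r.stk (((r.emit ((List.finRange φ.numVars).flatMap (encodeVar φ))).set
      .rem 0).set .i φ.numVars).stk (B * (120 * B * B + 338 * B + 121) + 1) := by
  refine (run_whilePos (n := φ.numVars) (fun t =>
    ((r.emit (((List.finRange φ.numVars).take t).flatMap (encodeVar φ))).set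
      .rem (φ.numVars - t)).set .i t) (120 * B * B + 338 * B + 120)
    (RegState.ext ?_ ?_ ?_ ?_ (funext fun d => ?_)) rfl (fun t ht => ?_) (by simp)
    (fun t hlt => ?_)).congr ?_ ?_
  · simp
  · simp
  · simp
  · simp
  · simp
    grind
  · simp
    omega
  · refine (run_varProg φ (i := ⟨t, hlt⟩) (by simpa using h) (by simpa using hs)
      (by simpa using ht) (by simpa using hd) (by simpa using hh) (by simpa using hj)
      (by simp) (by simpa using hv) hk (by simpa using hB) hm).congr
      (congrArg _ (RegState.ext ?_ ?_ ?_ ?_ (funext fun d => ?_))) le_rfl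
    · simp
    · simp
    · rw [RegState.set_emitted, RegState.set_emitted, RegState.emit_emitted,
        List.take_succ_eq_append_getElem (by simpa using hlt), List.flatMap_append]
      simp
    · simp
    · simp
      grind
  · simp [List.take_of_length_le]
  · exact Nat.add_le_add_right (Nat.mul_le_mul_right _ hk) 1

/-! ### The final thread -/

/-- Removes a literal from the input. -/
def skipLit : StackProg Reg.Γ := seq (pop .inp) (whileTick (pop .inp))

theorem run_skipLit {k : ℕ} {l : Lit k} {rest : List FormulaSym}
    (h : r.inp = encodeLit l ++ rest) (hrest : rest.head? ≠ some FormulaSym.tick) (hk : k ≤ B) :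
    RunsIn skipLit r.stk (RegState.stk { r with inp := rest }) (2 * B + 2) := by
  have hl := l.1.2
  refine ((run_pop_inp h).seq (run_whileTick (n := l.1) (r' := { r with inp := rest })
    (fun t => { r with inp := List.replicate (l.1 - t) FormulaSym.tick ++ rest }) 1 ?_ ?_
    (fun t ht => head?_ticks (by omega)) (by simpa using hrest) fun t ht => ?_)).mono ?_
  · simp
  · simp
  · refine (run_pop_inp (ticks_eq_cons (by omega))).congr ?_ le_rfl
    simp [Nat.sub_sub]
  · omega

/-- Removes a clause from the input, and emits a read. -/
def clauseReadProg : StackProg Reg.Γ :=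
  seq skipLit (seq skipLit (seq skipLit (seq (emitEvent .read [.vars, .vars, .j] 1) (inc .j))))

theorem run_clauseReadProg {k : ℕ} {C : Fin 3 → Lit k} {rest : List FormulaSym}
    (h : r.inp = encodeClause C ++ rest) (hrest : rest.head? ≠ some FormulaSym.tick)
    (ht : r.cnt .tmp = 0) (hv : r.cnt .vars = k) (hk : k ≤ B) (hj : r.cnt .j ≤ B) :
    RunsIn clauseReadProg r.stk ((({ r with inp := rest } : RegState).emit
      (MemEvent.encode ⟨.read, 2 * k + r.cnt .j, 1⟩)).set .j (r.cnt .j + 1)).stk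
      (30 * B + 20) := by
  rw [encodeClause_eq, List.append_assoc, List.append_assoc] at h
  refine ((run_skipLit h (head?_encodeLit _ _) hk).seq ((run_skipLit rfl (head?_encodeLit _ _)
    hk).seq ((run_skipLit rfl hrest hk).seq ((run_emitEvent (r := { r with inp := rest }) (B := B)
      (x := 2 * k + r.cnt .j) (by simp) ht (by simp [hv, hk, hj]) (by simp [hv]; omega) (by simp)
      (by simp)).seq run_inc)))).congr rfl (by omega)

theorem run_clauseReadProgs {k : ℕ} (cs : List (Fin 3 → Lit k))
    (h : r.inp = cs.flatMap encodeClause) (ht : r.cnt .tmp = 0)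
    (hv : r.cnt .vars = k) (hk : k ≤ B) (hj : r.cnt .j + cs.length ≤ B) :
    RunsIn (loop .inp Option.isSome clauseReadProg) r.stk
      ((({ r with inp := [] } : RegState).emit
        (indexedFlatMap (fun _ => True)
          (fun j => MemEvent.encode ⟨.read, 2 * k + j, 1⟩) cs (r.cnt .j))).set
        .j (r.cnt .j + cs.length)).stk (cs.length * (30 * B + 21) + 1) := by
  induction cs generalizing r with
  | nil =>
    refine (run_loop_inp_nil h).congr (congrArg _
      (RegState.ext ?_ ?_ ?_ ?_ (funext fun d => ?_))) (by omega)
    · simpa using h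
    · simp
    · simp [indexedFlatMap]
    · simp
    · simp
      grind
  | cons C cs ih =>
    rw [List.length_cons] at hj
    rw [List.flatMap_cons] at h
    refine (run_loop_inp_pos (by rw [h]; exact encodeClause_ne_nil _ _)
      (run_clauseReadProg h (head?_encodeClauses cs) ht hv hk (by omega))
      (ih rfl (by simpa using ht) (by simpa using hv) (by simp; omega))).congr (congrArg _
      (RegState.ext ?_ ?_ ?_ ?_ (funext fun d => ?_))) ?_
    · simp
    · simp
    · simp [indexedFlatMap]
    · simp
    · simp
      grind
    · rw [List.length_cons, add_mul]
      omega

/-- Emits the reads of the locations `s_i`. -/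
def varReadProg : StackProg Reg.Γ :=
  whilePos .rem (seq (dec .rem) (seq (emitEvent .read [.i] 2)
    (seq (emitEvent .read [.i] 1) (inc .i))))

/-- The encoding of the reads of the locations `s_i`. -/
def encodeVarRead (i : ℕ) : List ExecSym :=
  MemEvent.encode ⟨.read, i, 2⟩ ++ MemEvent.encode ⟨.read, i, 1⟩

theorem run_varReadProg (ht : r.cnt .tmp = 0) (hi : r.cnt .i = 0) (hr : r.cnt .rem = n)
    (hn : n ≤ B) : RunsIn varReadProg r.stk (((r.emit ((List.range n).flatMap encodeVarRead)).set
      .rem 0).set .i n).stk (B * (48 * B + 29) + 1) := by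
  refine (run_whilePos (n := n) (fun t => ((r.emit ((List.range t).flatMap encodeVarRead)).set
      .rem (n - t)).set .i t) (48 * B + 28)
    (RegState.ext ?_ ?_ ?_ ?_ (funext fun d => ?_)) rfl (fun t ht => ?_) (by simp)
    (fun t hlt => ?_)).congr ?_ ?_
  · simp
  · simp
  · simp
  · simp
  · simp
    grind
  · simp
    omega
  · refine (run_dec.seq ((run_emitEvent (r := RegState.set _ _ _) (B := B) (x := t) (by simp)
      (by simpa using ht) (by simp; omega) (by simp) (by simp) (by simp)).seq
      ((run_emitEvent (r := (RegState.set _ _ _).emit _) (B := B) (x := t) (by simp)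
      (by simpa using ht) (by simp; omega) (by simp) (by simp) (by simp)).seq run_inc))).congr
      (congrArg _ (RegState.ext ?_ ?_ ?_ ?_ (funext fun d => ?_))) (by omega)
    · simp
    · simp
    · simp [List.range_succ, encodeVarRead]
    · simp
    · simp
      grind
  · simp
  · exact Nat.add_le_add_right (Nat.mul_le_mul_right _ hn) 1

/-- Emits the thread `T_f`. -/
def finalProg : StackProg Reg.Γ :=
  seq (loop .inp Option.isSome clauseReadProg) (seq (moveCnt .i .rem)
    (seq varReadProg (emitWord [.semi])))

theorem encodeThread_finalThread (φ : Formula3) : encodeThread φ.finalThread =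
    indexedFlatMap (fun _ => True)
      (fun j => MemEvent.encode ⟨.read, 2 * φ.numVars + j, 1⟩) φ.clauses 0 ++
      ((List.range φ.numVars).flatMap encodeVarRead ++ [.semi]) := by
  rw [indexedFlatMap_eq, encodeThread, Formula3.finalThread, List.flatMap_append, List.append_assoc,
    List.flatMap_map, List.flatMap_assoc, ← List.map_coe_finRange_eq_range, List.flatMap_map]
  simp [Formula3.sLoc, Formula3.cLoc, encodeVarRead]

/-- This last pass may consume the input. Afterwards `.i` still holds the number of variables, and
moving it to `.rem` prepares both counters for the loop over the `s_i`. -/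
theorem run_finalProg (φ : Formula3)
    (h : r.inp = φ.clauses.flatMap encodeClause) (ht : r.cnt .tmp = 0) (hj : r.cnt .j = 0)
    (hi : r.cnt .i = φ.numVars) (hv : r.cnt .vars = φ.numVars) (hr : r.cnt .rem = 0)
    (hk : φ.numVars ≤ B) (hm : φ.clauses.length ≤ B) :
    RunsIn finalProg r.stk ((({ r with inp := [] } : RegState).emit
      (encodeThread φ.finalThread)).set .j φ.clauses.length).stk
      (B * (78 * B + 54) + 5) := by
  refine ((run_clauseReadProgs φ.clauses h ht hv hk (by omega)).seq ((run_moveCnt (by simp)).seq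
    ((run_varReadProg (n := φ.numVars) (by simpa using ht) (by simp) (by simp [hi, hr]) hk).seq
      (run_emitWord _)))).congr (congrArg _
      (RegState.ext ?_ ?_ ?_ ?_ (funext fun d => ?_))) ?_
  · simp
  · simp
  · rw [encodeThread_finalThread]
    simp [hj]
  · simp
  · simp
    grind
  · have : φ.clauses.length * (30 * B + 21) ≤ B * (30 * B + 21) := Nat.mul_le_mul_right _ hm
    simp [hi]
    nlinarith

/-! ### The whole program -/

/-- Reads the number of variables. -/
def parseProg : StackProg Reg.Γ := whileTick (seq (pop .inp) (seq (inc .vars) (inc .rem)))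

theorem run_parseProg {rest : List FormulaSym}
    (h : r.inp = List.replicate n FormulaSym.tick ++ rest)
    (hrest : rest.head? ≠ some FormulaSym.tick) (hv : r.cnt .vars = 0) (hr : r.cnt .rem = 0)
    (hn : n ≤ B) : RunsIn parseProg r.stk
      ((({ r with inp := rest } : RegState).set .vars n).set .rem n).stk (4 * B + 1) := by
  refine (run_whileTick (n := n) (fun t => (({ r with
    inp := List.replicate (n - t) FormulaSym.tick ++ rest } : RegState).set .vars t).set .rem t) 3
    (RegState.ext ?_ ?_ ?_ ?_ (funext fun d => ?_)) rfl (fun t ht => head?_ticks (by omega))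
    (by simpa using hrest) (fun t ht => ?_)).congr ?_ ?_
  · simp [h]
  · simp
  · simp
  · simp
  · simp
    grind
  · refine ((run_pop_inp (ticks_eq_cons (n := n - t) (rest := rest) (by omega))).seq
      (run_inc.seq run_inc)).congr (congrArg _
      (RegState.ext ?_ ?_ ?_ ?_ (funext fun d => ?_))) le_rfl
    · simp [Nat.sub_sub]
    · simp
    · simp
    · simp
    · simp
      grind
  · simp
  · omega

/-- Moves the emitted word to the output stack. -/
def outputProg : StackProg Reg.Γ :=
  moveAll .emitted .out id [.tick, .read, .write, .comma, .semi]

/-- The last emitted symbol lies on top; the move reverses the word, so that the output stack starts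
with the first symbol. -/
theorem run_outputProg (h : r.out = []) : RunsIn outputProg r.stk
    (RegState.stk { r with out := r.emitted.reverse, emitted := [] })
    (r.emitted.length * 8 + 1) := by
  refine (RunsIn.moveAll (by simp) (fun x => by cases x <;> simp)).congr ?_ le_rfl
  rw [RegState.update_emitted, RegState.update_out]
  simp [RegState.stk, h]

/-- The program that computes the reduction. -/
def prog : StackProg Reg.Γ :=
  seq parseProg (seq varsProg (seq finalProg (seq outputProg
    (seq (clear (.cnt .j)) (seq (clear (.cnt .i)) (clear (.cnt .vars)))))))

theorem encode_toExec (φ : Formula3) : φ.toExec.encode =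
    (List.finRange φ.numVars).flatMap (encodeVar φ) ++ encodeThread φ.finalThread := by
  change _ = (List.finRange φ.numVars).flatMap (fun i => PartialExec.encode [φ.valueThread i true,
    φ.valueThread i false, φ.litThread (i, true), φ.litThread (i, false)]) ++ _
  simp [Formula3.toExec, PartialExec.encode, List.flatMap_append, List.flatMap_assoc, encodeThread]

/-- Every clause contributes at least its three signs. -/
theorem length_clauses_le (φ : Formula3) :
    φ.clauses.length ≤ (φ.clauses.flatMap encodeClause).length := by
  induction φ.clauses with
  | nil => simp
  | cons C cs ih =>
    rw [List.flatMap_cons, encodeClause_eq]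
    simp only [encodeLit, List.length_append, List.length_cons]
    omega

/-- The size of the execution, as a function of the size of the formula. -/
theorem numEvents_toExec_le (φ : Formula3) : φ.toExec.numEvents ≤
    2 * φ.encode.length * φ.encode.length + 11 * φ.encode.length := by
  have h := φ.numEvents_toExec_le
  have h1 : φ.numVars + φ.clauses.length ≤ φ.encode.length := by
    have := length_clauses_le φ
    rw [encode_eq]
    simp only [List.length_append, List.length_replicate]
    omega
  have h2 : φ.clauses.length * φ.numVars ≤ φ.encode.length * φ.encode.length :=
    Nat.mul_le_mul (by omega) (by omega)
  nlinarith

/-- The length of the output, as a function of the length of the input. -/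
noncomputable def sizeBound : Polynomial ℕ :=
  (2 * .X * .X + 11 * .X) * (2 * (2 * .X * .X + 11 * .X) + 2) + (4 * .X + 1)

theorem length_encode_toExec_le (φ : Formula3) :
    φ.toExec.encode.length ≤ sizeBound.eval φ.encode.length := by
  have h := (Formula3.hasSmallNames_toExec φ).length_encode_le
  have h1 := numEvents_toExec_le φ
  have h2 : φ.numVars ≤ φ.encode.length := by
    rw [encode_eq]
    simp
  rw [φ.numThreads_toExec] at h
  simp only [sizeBound, Polynomial.eval_add, Polynomial.eval_mul, Polynomial.eval_X,
    Polynomial.eval_ofNat, Polynomial.eval_one]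
  refine h.trans (Nat.add_le_add (Nat.mul_le_mul h1 ?_) ?_) <;> omega

/-- The running time of the reduction. -/
noncomputable def timeBound : Polynomial ℕ :=
  (4 * .X + 1) + ((.X * (120 * .X * .X + 338 * .X + 121) + 1) + ((.X * (78 * .X + 54) + 5) +
    ((sizeBound * 8 + 1) + (6 * .X + 3)))) + 1

/-- The last three loops clear `.j`, `.i` and `.vars`, the only counters that are possibly nonzero
at that point, because an output requires all other stacks to be empty. They account for the summand
`6 * φ.encode.length + 3`. -/
theorem run_prog (φ : Formula3) :
    RunsIn prog (Function.update (fun _ => []) Reg.inp φ.encode)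
      (Function.update (fun _ => []) Reg.out φ.toExec.encode)
      ((4 * φ.encode.length + 1) + ((φ.encode.length * (120 * φ.encode.length * φ.encode.length +
        338 * φ.encode.length + 121) + 1) + ((φ.encode.length * (78 * φ.encode.length + 54) + 5) +
        ((sizeBound.eval φ.encode.length * 8 + 1) + (6 * φ.encode.length + 3))))) := by
  have h2 : φ.numVars ≤ φ.encode.length := by
    rw [encode_eq]
    simp
  have h3 : (φ.clauses.flatMap encodeClause).length ≤ φ.encode.length := by
    rw [encode_eq]
    simp
  have h4 := length_clauses_le φ
  have h5 := length_encode_toExec_le φ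
  have h0 : (fun _ => [] : ∀ k, List (Reg.Γ k)) = RegState.stk ⟨[], [], [], [], fun _ => 0⟩ := by
    funext k
    cases k <;> rfl
  rw [h0, RegState.update_inp, RegState.update_out]
  refine ((run_parseProg (encode_eq φ) (head?_encodeClauses _) rfl rfl h2).seq
    ((run_varsProg φ (by simp) (by simp) (by simp) (by simp) (by simp) (by simp) (by simp)
      (by simp) (by simp) h2 (by simpa using h3) (by omega)).seq
    ((run_finalProg φ (by simp) (by simp) (by simp) (by simp) (by simp) (by simp) h2
      (by omega)).seq ((run_outputProg (by simp)).seq (run_clear_cnt.seq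
        (run_clear_cnt.seq run_clear_cnt)))))).congr (congrArg _
      (RegState.ext ?_ ?_ ?_ ?_ (funext fun d => ?_))) ?_
  · simp
  · simp
  · simp
  · simp [encode_toExec]
  · cases d <;> simp
  · rw [encode_toExec] at h5
    simp only [List.length_append] at h5
    simp [-List.length_flatMap]
    omega

/-- The reduction is computable in polynomial time. -/
noncomputable def computable :
    TM2ComputableInPolyTime Formula3.encode PartialExec.encode Formula3.toExec where
  tm := prog.toTM2 .inp .out
  inputAlphabet := Equiv.refl FormulaSym
  outputAlphabet := Equiv.refl ExecSym
  time := timeBound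
  outputsFun φ := Classical.choice (nonempty_outputsInTime_congr (run_prog φ).outputsInTime
    (List.map_id _) (List.map_id _) (by simp [timeBound]))

end Reduction

/-! ### The running time of the composed algorithm -/

theorem Polynomial.eval_nat_le (p : Polynomial ℕ) (n : ℕ) :
    p.eval n ≤ p.eval 1 * (n + 1) ^ p.natDegree := by
  -- Coefficients are nonnegative with sum `p.eval 1`, and each power of `n` in `p` is at most `(n +
  -- 1) ^ p.natDegree`.
  rw [eval_eq_sum_range, eval_eq_sum_range, Finset.sum_mul]
  refine Finset.sum_le_sum fun i hi => ?_
  rw [one_pow, mul_one]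
  refine Nat.mul_le_mul_left _ ((Nat.pow_le_pow_left (Nat.le_succ n) i).trans
    (Nat.pow_le_pow_right (Nat.succ_pos n) ?_))
  exact Nat.lt_succ_iff.1 (Finset.mem_range.1 hi)

/-- A bound for the sum of a polynomial and a subexponential running time on an instance of
polynomial size. -/
theorem exists_time_bound (p q : Polynomial ℕ) (C c : ℕ) : ∃ C' c' : ℕ, ∀ (L n : ℕ) (x : ℝ),
    n ≤ q.eval L → ((p.eval L : ℕ) : ℝ) + C * (2 : ℝ) ^ x * ((n : ℝ) + 1) ^ c ≤
      C' * (2 : ℝ) ^ |x| * ((L : ℝ) + 1) ^ c' := by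
  -- The absolute value of the exponent makes `2 ^ |x|` at least 1, so that it also absorbs the
  -- polynomial summand; `x` itself may be negative.
  refine ⟨p.eval 1 + C * (q.eval 1 + 1) ^ c, p.natDegree + q.natDegree * c, fun L n x hn => ?_⟩
  have hL : (1 : ℝ) ≤ (L : ℝ) + 1 := by
    have : (0 : ℝ) ≤ L := Nat.cast_nonneg L
    linarith
  have h2 : (1 : ℝ) ≤ (2 : ℝ) ^ |x| := Real.one_le_rpow (by norm_num) (abs_nonneg x)
  have hp : ((p.eval L : ℕ) : ℝ) ≤ ((p.eval 1 : ℕ) : ℝ) * ((L : ℝ) + 1) ^ p.natDegree := by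
    exact_mod_cast p.eval_nat_le L
  have hq : (n : ℝ) + 1 ≤ (((q.eval 1 : ℕ) : ℝ) + 1) * ((L : ℝ) + 1) ^ q.natDegree := by
    have h : (n : ℝ) ≤ ((q.eval 1 : ℕ) : ℝ) * ((L : ℝ) + 1) ^ q.natDegree := by
      exact_mod_cast hn.trans (q.eval_nat_le L)
    have := one_le_pow₀ hL (n := q.natDegree)
    linarith
  have h3 : ((n : ℝ) + 1) ^ c ≤
      (((q.eval 1 : ℕ) : ℝ) + 1) ^ c * ((L : ℝ) + 1) ^ (q.natDegree * c) := by
    rw [pow_mul, ← mul_pow]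
    exact pow_le_pow_left₀ (by positivity) hq c
  have h4 : (2 : ℝ) ^ x ≤ (2 : ℝ) ^ |x| :=
    Real.rpow_le_rpow_of_exponent_le (by norm_num) (le_abs_self x)
  have h5 : ((L : ℝ) + 1) ^ p.natDegree ≤ ((L : ℝ) + 1) ^ (p.natDegree + q.natDegree * c) :=
    pow_le_pow_right₀ hL (by omega)
  have h6 : ((L : ℝ) + 1) ^ (q.natDegree * c) ≤ ((L : ℝ) + 1) ^ (p.natDegree + q.natDegree * c) :=
    pow_le_pow_right₀ hL (by omega)
  have hpc : (0 : ℝ) ≤ ((p.eval 1 : ℕ) : ℝ) := Nat.cast_nonneg _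
  have hqc : (0 : ℝ) ≤ ((q.eval 1 : ℕ) : ℝ) + 1 := by positivity
  calc ((p.eval L : ℕ) : ℝ) + C * (2 : ℝ) ^ x * ((n : ℝ) + 1) ^ c
      ≤ ((p.eval 1 : ℕ) : ℝ) * (1 * ((L : ℝ) + 1) ^ p.natDegree) + C * (2 : ℝ) ^ |x| *
          ((((q.eval 1 : ℕ) : ℝ) + 1) ^ c * ((L : ℝ) + 1) ^ (q.natDegree * c)) := by
        rw [one_mul]
        gcongr
    _ ≤ ((p.eval 1 : ℕ) : ℝ) * ((2 : ℝ) ^ |x| * ((L : ℝ) + 1) ^ (p.natDegree + q.natDegree * c)) +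
          C * (2 : ℝ) ^ |x| *
          ((((q.eval 1 : ℕ) : ℝ) + 1) ^ c * ((L : ℝ) + 1) ^ (p.natDegree + q.natDegree * c)) := by
        gcongr
    _ = _ := by
        push_cast
        ring

/-- The composition of the reduction with an algorithm for the consistency of executions. -/
theorem exists_solver_of_solvesInSubexpTime (M : MemModel) (A : TM2ComputableAux ExecSym Bool)
    (hA : SolvesInSubexpTime 3 M A) :
    ∃ (A : TM2ComputableAux FormulaSym Bool) (f : ℕ → ℝ) (C c : ℕ),
    (f =o[atTop] fun k : ℕ => (k : ℝ)) ∧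
    ∀ φ : Formula3, DecidesInTime A φ.encode φ.Satisfiable
      (C * (2 : ℝ) ^ f φ.numVars * ((φ.encode.length : ℝ) + 1) ^ c) := by
  obtain ⟨f, C, c, hf, hA⟩ := hA
  have R := Reduction.computable
  obtain ⟨C', c', hC⟩ := exists_time_bound (R.time + 2 * (Reduction.sizeBound + 1))
    (2 * .X * .X + 11 * .X) C c
  have : Inhabited (A.tm.Γ A.tm.k₀) := ⟨A.inputAlphabet.symm .tick⟩
  -- The new exponent is `|f (4k + 1)|`, because the execution has `4k + 1` threads. It is `o(k)`
  -- since `4k + 1 ≤ 5k` for `k ≥ 1`.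
  refine ⟨⟨FinTM2.comp R.tm A.tm (R.outputAlphabet.trans A.inputAlphabet.symm), R.inputAlphabet,
    A.outputAlphabet⟩, fun k => |f (4 * k + 1)|, C', c', ?_, fun φ => ?_⟩
  · refine (IsLittleO.trans_isBigO (hf.comp_tendsto (k := fun k : ℕ => 4 * k + 1) ?_) ?_).abs_left
    · exact tendsto_atTop_mono (fun k => by simp only [id]; omega) tendsto_id
    · refine IsBigO.of_bound 5 (eventually_atTop.2 ⟨1, fun k hk => ?_⟩)
      have : (1 : ℝ) ≤ k := by exact_mod_cast hk
      simp only [Function.comp_apply, Nat.cast_add, Nat.cast_mul, Nat.cast_ofNat, Nat.cast_one]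
      rw [Real.norm_of_nonneg (by positivity), Real.norm_of_nonneg (by positivity)]
      linarith
  · obtain ⟨b, s, hb, hs, h⟩ := hA φ.toExec φ.isWriterBounded_toExec φ.hasSmallNames_toExec
    rw [φ.consistent_iff_satisfiable] at hb
    refine ⟨b, R.time.eval φ.encode.length + 2 * (φ.toExec.encode.length + 1) + s, hb, ?_, ?_⟩
    · refine le_trans ?_ (hC φ.encode.length φ.toExec.numEvents (f (4 * φ.numVars + 1))
        (by simpa using Reduction.numEvents_toExec_le φ))
      rw [φ.numThreads_toExec] at hs
      rw [Nat.cast_add]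
      refine add_le_add (Nat.cast_le.2 ?_) hs
      have := Reduction.length_encode_toExec_le φ
      simp only [Polynomial.eval_add, Polynomial.eval_mul, Polynomial.eval_ofNat,
        Polynomial.eval_one]
      omega
    · have h' := FinTM2.comp_outputsInTime (R.outputAlphabet.trans A.inputAlphabet.symm)
        ⟨R.outputsFun φ⟩ (nonempty_outputsInTime_congr h (by simp) rfl le_rfl)
      refine nonempty_outputsInTime_congr h' rfl rfl (by simp)

theorem mainTheorem3 :
    (ETH → ∀ M : MemModel, ¬ ∃ A : TM2ComputableAux ExecSym Bool, SolvesInSubexpTime 3 M A) ∧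
    Nonempty (TM2ComputableInPolyTime Formula3.encode PartialExec.encode Formula3.toExec) ∧
    ∀ φ : Formula3,
      φ.toExec.IsWriterBounded 3 ∧ φ.toExec.HasSmallNames ∧
      φ.toExec.numThreads = 4 * φ.numVars + 1 ∧
      (φ.Satisfiable → φ.toExec.Consistent MemModel.SRA) ∧
      (φ.toExec.Consistent MemModel.WRA → φ.Satisfiable) := by
  refine ⟨fun hETH M ⟨A, hA⟩ => hETH (exists_solver_of_solvesInSubexpTime M A hA),
    ⟨Reduction.computable⟩, fun φ => ⟨φ.isWriterBounded_toExec, φ.hasSmallNames_toExec,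
      φ.numThreads_toExec, Formula3.consistent_SRA_of_satisfiable,
      Formula3.satisfiable_of_consistent_WRA⟩⟩
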